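/- Let $\mathsf{Rat}_1$ be the space of rational maps $W(z)=\frac{a_1z+a_2}{a_3z+a_4}$ with $a_1a_4-a_2a_3\neq 0$. Identifying a map with the class $[L]$ of its coefficient matrix, up to nonzero complex scalars, $\mathsf{Rat}_1\cong PGL(2,\mathbb C)$ is a complex $3$-manifold with holomorphic charts $(a_k/a_i)_{k\ne i}$ on $\{a_i\neq 0\}$. The group $SO(3)\times SO(3)\cong PU(2)\times PU(2)$ acts on it by $([U_1],[U_2]):[L]\mapsto[U_1LU_2^{-1}]$. Let $\tau_1,\tau_2,\tau_3$ be the Pauli matrices. For $U\in U(2)$ let $Ad_U\in SO(3)$ be the matrix of $X\mapsto UXU^{-1}$ on $\mathfrak{su}(2)$ in the basis $\frac i2\tau_a$; this identifies $PU(2)$ with $SO(3)$. The polar decomposition gives a bijection $$SO(3)\times\mathbb R^3\to\mathsf{Rat}_1,\qquad (Ad_U,\lambda)\mapsto\Big[U\big(\sqrt{1+|\lambda|^2}\,\mathbb I_2+\lambda\cdot\tau\big)\Big].$$ Let $\theta_1,\theta_2,\theta_3$ be the left-invariant vector fields on $SO(3)$ corresponding to the basis $\frac i2\tau_a$ of $\mathfrak{su}(2)\cong\mathfrak{so}(3)$,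 and identify $SO(3)\times\mathbb R^3$ with $TSO(3)$ via $(R,\lambda)\mapsto(\lambda\cdot\theta)(R)\in T_RSO(3)$. In this way $TSO(3)\cong\mathsf{Rat}_1$. Let $f:SO(3)\to SO(3)$, $f(R)=R^{-1}$, with differential $df:TSO(3)\to TSO(3)$. Then in terms of $SO(3)\times\mathbb R^3$ $$df(R,\lambda)=(R^{-1},-Ad_R\lambda),\qquad Ad_R\lambda=R\lambda ,$$ and, for every smooth $SO(3)\times SO(3)$-invariant Kähler metric $\gamma$ on $\mathsf{Rat}_1$, the map of $\mathsf{Rat}_1$ corresponding to $df$ is an isometry of $\gamma$, that is, a diffeomorphism preserving $\gamma$. -/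

import Mathlib

open scoped Matrix MatrixGroups Manifold ContDiff

noncomputable section

namespace RatOne

/-! ### The complex manifold of degree one rational maps -/

/-- The space of rational maps `(a₁ z + a₂) / (a₃ z + a₄)` with `a₁ a₄ - a₂ a₃ ≠ 0`: such a map is
the class, up to a common nonzero factor, of its invertible coefficient matrix. -/
abbrev Rat1 : Type := PGL(2, ℂ)

/-- The class `[L]` of an invertible matrix. -/
abbrev cls : GL (Fin 2) ℂ →* Rat1 := Matrix.ProjGenLinGroup.mk

/-- The coordinate space `ℂ³`. -/
abbrev C3 : Type := Fin 3 → ℂ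

instance : TopologicalSpace Rat1 :=
  inferInstanceAs (TopologicalSpace (GL (Fin 2) ℂ ⧸ Subgroup.center (GL (Fin 2) ℂ)))

/-- The coefficients `(a₁, a₂, a₃, a₄)` of a matrix. -/
def coeffs (L : Matrix (Fin 2) (Fin 2) ℂ) : Fin 4 → ℂ := ![L 0 0, L 0 1, L 1 0, L 1 1]

/-- The matrix with coefficients `(a₁, a₂, a₃, a₄)`. -/
def ofCoeffs (a : Fin 4 → ℂ) : Matrix (Fin 2) (Fin 2) ℂ := !![a 0, a 1; a 2, a 3]

theorem ofCoeffs_coeffs (L : Matrix (Fin 2) (Fin 2) ℂ) : ofCoeffs (coeffs L) = L := by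
  ext i j; fin_cases i <;> fin_cases j <;> rfl

theorem coeffs_ofCoeffs (a : Fin 4 → ℂ) : coeffs (ofCoeffs a) = a := by
  ext i; fin_cases i <;> rfl

theorem coeffs_smul (c : ℂ) (L : Matrix (Fin 2) (Fin 2) ℂ) : coeffs (c • L) = c • coeffs L := by
  ext i; fin_cases i <;> rfl

theorem ofCoeffs_smul (c : ℂ) (a : Fin 4 → ℂ) : ofCoeffs (c • a) = c • ofCoeffs a := by
  ext i j; fin_cases i <;> fin_cases j <;> rfl

theorem continuous_coeffs : Continuous coeffs := by
  refine continuous_pi fun i => ?_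
  fin_cases i <;> simp only [coeffs] <;> exact continuous_id.matrix_elem _ _

theorem contDiff_det_ofCoeffs (𝕜 : Type) [RCLike 𝕜] [NormedAlgebra 𝕜 ℂ] :
    ContDiff 𝕜 ω fun a : Fin 4 → ℂ => (ofCoeffs a).det := by
  simp only [ofCoeffs, Matrix.det_fin_two_of]
  fun_prop

theorem cls_eq_cls {L M : GL (Fin 2) ℂ} :
    cls L = cls M ↔ ∃ c : ℂ, c ≠ 0 ∧ (M : Matrix (Fin 2) (Fin 2) ℂ) = c • L.1 := by
  rw [Matrix.ProjGenLinGroup.mk_eq_mk_iff]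
  have key : ∀ u : ℂˣ, (L * Matrix.GeneralLinearGroup.scalar (Fin 2) u).1 = (u : ℂ) • L.1 := by
    intro u
    rw [Units.val_mul, Matrix.GeneralLinearGroup.coe_scalar]
    ext i j
    simp [mul_comm]
  constructor
  · rintro ⟨u, rfl⟩
    exact ⟨u, u.ne_zero, key u⟩
  · rintro ⟨c, hc, h⟩
    exact ⟨Units.mk0 c hc, Units.ext (by rw [h, key]; rfl)⟩

/-- A choice of representative matrix. -/
def rep (p : Rat1) : GL (Fin 2) ℂ := Function.surjInv Matrix.ProjGenLinGroup.mk_surjective p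

theorem cls_rep (p : Rat1) : cls (rep p) = p := Function.surjInv_eq _ p

/-- The set of classes whose coefficient `a_i` does not vanish. -/
def chartDom (i : Fin 4) : Set Rat1 := {p | coeffs (rep p).1 i ≠ 0}

/-- The chart `q_k = a_k / a_i` (`k ≠ i`), on the set where `a_i ≠ 0`. -/
def chartFun (i : Fin 4) (p : Rat1) : C3 := fun k =>
  coeffs (rep p).1 (i.succAbove k) / coeffs (rep p).1 i

/-- The image of the `i`-th chart. -/
def chartRange (i : Fin 4) : Set C3 := {q | (ofCoeffs (i.insertNth 1 q)).det ≠ 0}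

open scoped Classical in
/-- The inverse of the `i`-th chart: put `a_i = 1`. -/
def chartInv (i : Fin 4) (q : C3) : Rat1 :=
  if h : (ofCoeffs (i.insertNth 1 q)).det ≠ 0 then
    cls (Matrix.GeneralLinearGroup.mkOfDetNeZero _ h)
  else 1

theorem mem_chartDom_cls {i : Fin 4} {L : GL (Fin 2) ℂ} :
    cls L ∈ chartDom i ↔ coeffs L.1 i ≠ 0 := by
  obtain ⟨c, hc, h⟩ := cls_eq_cls.1 (cls_rep (cls L))
  simp [chartDom, h, coeffs_smul, hc]

theorem chartFun_cls (i : Fin 4) (L : GL (Fin 2) ℂ) (k : Fin 3) :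
    chartFun i (cls L) k = coeffs L.1 (i.succAbove k) / coeffs L.1 i := by
  obtain ⟨c, hc, h⟩ := cls_eq_cls.1 (cls_rep (cls L))
  simp [chartFun, h, coeffs_smul, mul_div_mul_left _ _ hc]

theorem mem_chartRange {i : Fin 4} {q : C3} :
    q ∈ chartRange i ↔ (ofCoeffs (i.insertNth 1 q)).det ≠ 0 := Iff.rfl

theorem chartInv_of_mem {i : Fin 4} {q : C3} (h : (ofCoeffs (i.insertNth 1 q)).det ≠ 0) :
    chartInv i q = cls (Matrix.GeneralLinearGroup.mkOfDetNeZero _ h) :=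
  dif_pos h

theorem coeffs_mkOfDetNeZero (a : Fin 4 → ℂ) (h : (ofCoeffs a).det ≠ 0) :
    coeffs (Matrix.GeneralLinearGroup.mkOfDetNeZero (ofCoeffs a) h).1 = a :=
  coeffs_ofCoeffs a

theorem insertNth_chartFun {i : Fin 4} {L : GL (Fin 2) ℂ} (h : coeffs L.1 i ≠ 0) :
    (i.insertNth 1 (chartFun i (cls L)) : Fin 4 → ℂ) = (coeffs L.1 i)⁻¹ • coeffs L.1 := by
  ext l
  rcases Fin.eq_self_or_eq_succAbove i l with rfl | ⟨k, rfl⟩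
  · simp [h]
  · simp [chartFun_cls, div_eq_inv_mul]

theorem chartFun_mem {i : Fin 4} {p : Rat1} (hp : p ∈ chartDom i) :
    chartFun i p ∈ chartRange i := by
  obtain ⟨L, rfl⟩ := Matrix.ProjGenLinGroup.mk_surjective p
  have h := mem_chartDom_cls.1 hp
  have hL : L.1.det ≠ 0 := (L.1.isUnit_iff_isUnit_det.1 L.isUnit).ne_zero
  rw [mem_chartRange, insertNth_chartFun h, ofCoeffs_smul, ofCoeffs_coeffs, Matrix.det_smul]
  exact mul_ne_zero (pow_ne_zero _ (inv_ne_zero h)) hL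

theorem chartInv_chartFun {i : Fin 4} {p : Rat1} (hp : p ∈ chartDom i) :
    chartInv i (chartFun i p) = p := by
  rw [chartInv_of_mem (mem_chartRange.1 (chartFun_mem hp))]
  obtain ⟨L, rfl⟩ := Matrix.ProjGenLinGroup.mk_surjective p
  have h := mem_chartDom_cls.1 hp
  refine cls_eq_cls.2 ⟨coeffs L.1 i, h, ?_⟩
  change L.1 = coeffs L.1 i • ofCoeffs (i.insertNth 1 (chartFun i (cls L)))
  rw [insertNth_chartFun h, ofCoeffs_smul, ofCoeffs_coeffs, smul_smul, mul_inv_cancel₀ h, one_smul]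

theorem chartInv_mem {i : Fin 4} {q : C3} (hq : q ∈ chartRange i) :
    chartInv i q ∈ chartDom i := by
  rw [chartInv_of_mem (mem_chartRange.1 hq), mem_chartDom_cls, coeffs_mkOfDetNeZero]
  simp

theorem chartFun_chartInv' {i j : Fin 4} {q : C3} (hq : q ∈ chartRange i) (k : Fin 3) :
    chartFun j (chartInv i q) k =
      (i.insertNth 1 q : Fin 4 → ℂ) (j.succAbove k) / (i.insertNth 1 q : Fin 4 → ℂ) j := by
  rw [chartInv_of_mem (mem_chartRange.1 hq), chartFun_cls, coeffs_mkOfDetNeZero]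

theorem chartFun_chartInv {i : Fin 4} {q : C3} (hq : q ∈ chartRange i) :
    chartFun i (chartInv i q) = q := by
  ext k
  rw [chartFun_chartInv' hq]
  simp

theorem contDiff_insertNth (𝕜 : Type) [RCLike 𝕜] [NormedAlgebra 𝕜 ℂ] (i l : Fin 4) :
    ContDiff 𝕜 ω fun q : C3 => (i.insertNth 1 q : Fin 4 → ℂ) l := by
  rcases Fin.eq_self_or_eq_succAbove i l with rfl | ⟨k, rfl⟩
  · simpa using contDiff_const
  · simpa using contDiff_apply 𝕜 ℂ k

theorem continuous_insertNth (i : Fin 4) :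
    Continuous fun q : C3 => (i.insertNth 1 q : Fin 4 → ℂ) :=
  continuous_pi fun l => (contDiff_insertNth ℂ i l).continuous

theorem continuous_ofCoeffs : Continuous ofCoeffs := by
  refine continuous_matrix fun i j => ?_
  fin_cases i <;> fin_cases j <;> exact continuous_apply _

theorem isQuotientMap_cls : Topology.IsQuotientMap (cls : GL (Fin 2) ℂ → Rat1) :=
  isQuotientMap_quot_mk

theorem isOpen_chartDom (i : Fin 4) : IsOpen (chartDom i) := by
  rw [← isQuotientMap_cls.isOpen_preimage]
  have : cls ⁻¹' chartDom i = {L : GL (Fin 2) ℂ | coeffs L.1 i ≠ 0} := by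
    ext L; exact mem_chartDom_cls
  rw [this]
  exact isOpen_ne_fun
    ((continuous_apply i).comp (continuous_coeffs.comp Units.continuous_val)) continuous_const

theorem isOpen_chartRange (i : Fin 4) : IsOpen (chartRange i) :=
  isOpen_ne_fun ((continuous_ofCoeffs.comp (continuous_insertNth i)).matrix_det) continuous_const

theorem continuousOn_chartFun (i : Fin 4) : ContinuousOn (chartFun i) (chartDom i) := by
  rw [isQuotientMap_cls.continuousOn_isOpen_iff (isOpen_chartDom i)]
  refine continuousOn_pi.2 fun k => ?_
  have hc : ∀ l, Continuous fun L : GL (Fin 2) ℂ => coeffs L.1 l := fun l =>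
    (continuous_apply l).comp (continuous_coeffs.comp Units.continuous_val)
  refine ContinuousOn.congr (f := fun L : GL (Fin 2) ℂ =>
    coeffs L.1 (i.succAbove k) / coeffs L.1 i) ?_ ?_
  · exact (hc _).continuousOn.div (hc i).continuousOn fun L hL => mem_chartDom_cls.1 hL
  · exact fun L _ => chartFun_cls i L k

theorem continuousOn_chartInv (i : Fin 4) : ContinuousOn (chartInv i) (chartRange i) := by
  rw [continuousOn_iff_continuous_domRestrict]
  have hval : Continuous fun q : chartRange i => ofCoeffs (i.insertNth 1 q.1) :=
    (continuous_ofCoeffs.comp (continuous_insertNth i)).comp continuous_subtype_val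
  have h : Continuous fun q : chartRange i =>
      Matrix.GeneralLinearGroup.mkOfDetNeZero (ofCoeffs (i.insertNth 1 q.1)) q.2 := by
    rw [Units.continuous_iff]
    refine ⟨hval, ?_⟩
    have : (fun q : chartRange i => ((Matrix.GeneralLinearGroup.mkOfDetNeZero
        (ofCoeffs (i.insertNth 1 q.1)) q.2)⁻¹ : GL (Fin 2) ℂ).1) =
        fun q => ((ofCoeffs (i.insertNth 1 q.1)).det)⁻¹ • (ofCoeffs (i.insertNth 1 q.1)).adjugate := by
      ext1 q
      rw [Matrix.coe_units_inv, Matrix.inv_def, Ring.inverse_eq_inv']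
      rfl
    rw [this]
    exact (hval.matrix_det.inv₀ fun q => q.2).smul hval.matrix_adjugate
  refine (isQuotientMap_cls.continuous.comp h).congr fun q => ?_
  exact (chartInv_of_mem (mem_chartRange.1 q.2)).symm

/-- The `i`-th affine chart of the space of rational maps. -/
def chart (i : Fin 4) : OpenPartialHomeomorph Rat1 C3 where
  toFun := chartFun i
  invFun := chartInv i
  source := chartDom i
  target := chartRange i
  map_source' _ h := chartFun_mem h
  map_target' _ h := chartInv_mem h
  left_inv' _ h := chartInv_chartFun h
  right_inv' _ h := chartFun_chartInv h
  open_source := isOpen_chartDom i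
  open_target := isOpen_chartRange i
  continuousOn_toFun := continuousOn_chartFun i
  continuousOn_invFun := continuousOn_chartInv i

theorem exists_mem_chart (p : Rat1) : ∃ i, p ∈ (chart i).source := by
  obtain ⟨L, rfl⟩ := Matrix.ProjGenLinGroup.mk_surjective p
  by_contra! h
  have h0 : ∀ i, coeffs L.1 i = 0 := fun i => by
    by_contra hi
    exact h i (mem_chartDom_cls.2 hi)
  have hL : L.1 = 0 := by
    rw [← ofCoeffs_coeffs L.1, funext h0]
    ext i j; fin_cases i <;> fin_cases j <;> rfl
  exact L.ne_zero hL

instance : ChartedSpace C3 Rat1 where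
  atlas := Set.range chart
  chartAt p := chart (exists_mem_chart p).choose
  mem_chart_source p := (exists_mem_chart p).choose_spec
  chart_mem_atlas _ := ⟨_, rfl⟩

theorem isManifold (𝕜 : Type) [RCLike 𝕜] [NormedAlgebra 𝕜 ℂ] :
    IsManifold 𝓘(𝕜, C3) ω Rat1 := by
  refine isManifold_of_contDiffOn _ _ _ ?_
  rintro _ _ ⟨i, rfl⟩ ⟨j, rfl⟩
  simp only [modelWithCornersSelf_coe, modelWithCornersSelf_coe_symm, Set.range_id,
    Set.inter_univ, Set.preimage_id, Function.comp_id, Function.id_comp]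
  refine contDiffOn_pi.2 fun k => ?_
  have hq : ∀ q ∈ ((chart i).symm.trans (chart j)).source,
      q ∈ chartRange i ∧ chartInv i q ∈ chartDom j := fun q hq => hq
  refine ContDiffOn.congr (f := fun q : C3 => (i.insertNth 1 q : Fin 4 → ℂ) (j.succAbove k) /
    (i.insertNth 1 q : Fin 4 → ℂ) j) ?_ fun q h => chartFun_chartInv' (hq q h).1 k
  simp only [div_eq_mul_inv]
  refine (contDiff_insertNth 𝕜 i _).contDiffOn.mul
    ((contDiff_insertNth 𝕜 i j).contDiffOn.inv fun q h => ?_)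
  have h2 := (hq q h).2
  rwa [chartInv_of_mem (mem_chartRange.1 (hq q h).1), mem_chartDom_cls, coeffs_mkOfDetNeZero] at h2

/-- The space of rational maps of degree one is a complex manifold of dimension three. -/
instance : IsManifold 𝓘(ℂ, C3) ω Rat1 := isManifold ℂ

/-- The underlying real manifold. -/
instance : IsManifold 𝓘(ℝ, C3) ω Rat1 := isManifold ℝ

/-! ### Invariant Kähler metrics -/

/-- Smooth Riemannian metrics on the space of rational maps. -/
abbrev Metric : Type :=
  Bundle.ContMDiffRiemannianMetric 𝓘(ℝ, C3) ∞ C3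
    (TangentSpace 𝓘(ℝ, C3) : Rat1 → Type)

/-- The complex structure on the tangent space: multiplication by `i` in holomorphic charts. -/
def J (p : Rat1) (u : TangentSpace 𝓘(ℝ, C3) p) : TangentSpace 𝓘(ℝ, C3) p :=
  (Complex.I • (show C3 from u) : C3)

/-- The fundamental two-form `g(Ju, v)` of a metric, read in the coordinates of a chart `e`. -/
def formInChart (g : Metric) (e : OpenPartialHomeomorph Rat1 C3) (y u v : C3) : ℝ :=
  g.inner (e.symm y) (J _ (mfderiv 𝓘(ℝ, C3) 𝓘(ℝ, C3) e.symm y u))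
    (mfderiv 𝓘(ℝ, C3) 𝓘(ℝ, C3) e.symm y v)

/-- A Kähler metric: the complex structure is orthogonal and the fundamental two-form is closed,
the exterior derivative being written out on constant vector fields in each chart of the atlas. -/
structure IsKaehler (g : Metric) : Prop where
  hermitian : ∀ (p : Rat1) (u v : TangentSpace 𝓘(ℝ, C3) p), g.inner p (J p u) (J p v) = g.inner p u v
  closed : ∀ e ∈ atlas C3 Rat1, ∀ y ∈ e.target, ∀ u v w : C3,
    fderiv ℝ (fun x => formInChart g e x v w) y u + fderiv ℝ (fun x => formInChart g e x w u) y v +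
      fderiv ℝ (fun x => formInChart g e x u v) y w = 0

/-- The action `[L] ↦ [U₁ L U₂⁻¹]` of a pair of unitary matrices. -/
def act (U₁ U₂ : Matrix.unitaryGroup (Fin 2) ℂ) (p : Rat1) : Rat1 :=
  cls (Unitary.toUnits U₁) * p * (cls (Unitary.toUnits U₂))⁻¹

/-- `f` preserves lengths and angles of tangent vectors. -/
def PreservesMetric (g : Metric) (f : Rat1 → Rat1) : Prop :=
  ∀ (p : Rat1) (u v : TangentSpace 𝓘(ℝ, C3) p),
    g.inner (f p) (mfderiv 𝓘(ℝ, C3) 𝓘(ℝ, C3) f p u) (mfderiv 𝓘(ℝ, C3) 𝓘(ℝ, C3) f p v) =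
      g.inner p u v

/-- Invariance under `PU(2) × PU(2) = SO(3) × SO(3)`. -/
def IsInvariant (g : Metric) : Prop := ∀ U₁ U₂, PreservesMetric g (act U₁ U₂)

/-- An isometry: a diffeomorphism preserving the metric. -/
def IsIsometry (g : Metric) (f : Rat1 → Rat1) : Prop :=
  (∃ F : Rat1 ≃ₘ^∞⟮𝓘(ℝ, C3), 𝓘(ℝ, C3)⟯ Rat1, ⇑F = f) ∧ PreservesMetric g f

/-! ### Polar decomposition -/

/-- Rotations of `ℝ³`. -/
abbrev SO3 : Type := Matrix.specialOrthogonalGroup (Fin 3) ℝ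

/-- The Pauli matrices. -/
def pauli : Fin 3 → Matrix (Fin 2) (Fin 2) ℂ :=
  ![!![0, 1; 1, 0], !![0, -Complex.I; Complex.I, 0], !![1, 0; 0, -1]]

/-- `v · τ`. -/
def dotPauli (v : Fin 3 → ℝ) : Matrix (Fin 2) (Fin 2) ℂ := ∑ a, (v a : ℂ) • pauli a

/-- The basis `(i/2) τ_a` of `su(2)`. -/
def su2Basis (a : Fin 3) : Matrix (Fin 2) (Fin 2) ℂ := (Complex.I / 2) • pauli a

theorem dotPauli_eq (v : Fin 3 → ℝ) : dotPauli v =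
    !![(v 2 : ℂ), v 0 - v 1 * Complex.I; v 0 + v 1 * Complex.I, -v 2] := by
  ext i j
  fin_cases i <;> fin_cases j <;> simp [dotPauli, Fin.sum_univ_three, pauli, sub_eq_add_neg]

theorem dotPauli_injective : Function.Injective dotPauli := by
  intro v w h
  rw [dotPauli_eq, dotPauli_eq] at h
  have h2 := congrArg Complex.re (congrFun (congrFun h 0) 0)
  have h0 := congrArg Complex.re (congrFun (congrFun h 1) 0)
  have h1 := congrArg Complex.im (congrFun (congrFun h 1) 0)
  simp at h0 h1 h2
  ext i; fin_cases i <;> assumption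

/-- The coordinates of a traceless Hermitian matrix in the basis of Pauli matrices. -/
def pauliCoord (X : Matrix (Fin 2) (Fin 2) ℂ) : Fin 3 → ℝ := ![(X 1 0).re, (X 1 0).im, (X 0 0).re]

theorem dotPauli_pauliCoord {X : Matrix (Fin 2) (Fin 2) ℂ} (hX : Xᴴ = X) (ht : X.trace = 0) :
    dotPauli (pauliCoord X) = X := by
  have h00 := congrFun (congrFun hX 0) 0
  have h01 := congrFun (congrFun hX 0) 1
  simp only [Matrix.conjTranspose_apply, Complex.ext_iff] at h00 h01
  simp only [Matrix.trace_fin_two, Complex.ext_iff] at ht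
  simp at h00 h01 ht
  rw [dotPauli_eq]
  ext i j
  fin_cases i <;> fin_cases j <;> simp [pauliCoord, Complex.ext_iff] <;>
    (first | constructor <;> linarith | linarith)

theorem dotPauli_conjTranspose (v : Fin 3 → ℝ) : (dotPauli v)ᴴ = dotPauli v := by
  rw [dotPauli_eq]
  ext i j
  fin_cases i <;> fin_cases j <;> simp [Complex.ext_iff]

theorem dotPauli_trace (v : Fin 3 → ℝ) : (dotPauli v).trace = 0 := by
  simp [dotPauli_eq, Matrix.trace_fin_two]

theorem dotPauli_mul (v w : Fin 3 → ℝ) : dotPauli v * dotPauli w =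
    ((v ⬝ᵥ w : ℝ) : ℂ) • (1 : Matrix (Fin 2) (Fin 2) ℂ) + Complex.I • dotPauli (v ⨯₃ w) := by
  simp only [dotPauli_eq]
  ext i j
  fin_cases i <;> fin_cases j <;>
    simp [Complex.ext_iff, Matrix.mul_apply, Fin.sum_univ_two, dotProduct, Fin.sum_univ_three,
      cross_apply] <;> (first | constructor <;> ring | ring)

theorem dotPauli_single (b : Fin 3) : dotPauli (Pi.single b 1) = pauli b := by
  fin_cases b <;> rw [dotPauli_eq] <;> ext i j <;> fin_cases i <;> fin_cases j <;> simp [pauli]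

theorem dotPauli_linear (A : Matrix (Fin 3) (Fin 3) ℝ) (v : Fin 3 → ℝ) :
    dotPauli (A *ᵥ v) = ∑ b, (v b : ℂ) • dotPauli (fun c => A c b) := by
  simp only [dotPauli_eq]
  ext i j
  fin_cases i <;> fin_cases j <;>
    simp [Matrix.mulVec, dotProduct, Fin.sum_univ_three] <;> ring

/-- The matrix of `Ad_U` on `su(2)` in the basis `(i/2) τ_a`. -/
def AdMatrix (U : Matrix (Fin 2) (Fin 2) ℂ) : Matrix (Fin 3) (Fin 3) ℝ :=
  Matrix.of fun c b => pauliCoord (U * pauli b * Uᴴ) c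

section
variable {U : Matrix (Fin 2) (Fin 2) ℂ}

theorem AdMatrix_pauli (hU : Uᴴ * U = 1) (b : Fin 3) :
    dotPauli (fun c => AdMatrix U c b) = U * pauli b * Uᴴ := by
  refine dotPauli_pauliCoord ?_ ?_
  · rw [Matrix.conjTranspose_mul, Matrix.conjTranspose_mul, Matrix.conjTranspose_conjTranspose,
      ← dotPauli_single, dotPauli_conjTranspose, mul_assoc]
  · rw [Matrix.trace_mul_cycle, hU, one_mul, ← dotPauli_single, dotPauli_trace]

theorem AdMatrix_spec (hU : Uᴴ * U = 1) (v : Fin 3 → ℝ) :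
    dotPauli (AdMatrix U *ᵥ v) = U * dotPauli v * Uᴴ := by
  rw [dotPauli_linear, dotPauli, Finset.mul_sum, Finset.sum_mul]
  refine Finset.sum_congr rfl fun b _ => ?_
  rw [AdMatrix_pauli hU, Matrix.mul_smul, Matrix.smul_mul]

/-- `Ad_U ((i/2) τ_b) = ∑_c R_{cb} (i/2) τ_c`. -/
theorem AdMatrix_su2Basis (hU : Uᴴ * U = 1) (b : Fin 3) :
    U * su2Basis b * Uᴴ = ∑ c, (AdMatrix U c b : ℂ) • su2Basis c := by
  simp only [su2Basis, smul_comm _ (Complex.I / 2), ← Finset.smul_sum]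
  rw [Matrix.mul_smul, Matrix.smul_mul, ← AdMatrix_pauli hU]
  rfl

theorem AdMatrix_mul (hU : Uᴴ * U = 1) (v w : Fin 3 → ℝ) :
    (AdMatrix U *ᵥ v) ⬝ᵥ (AdMatrix U *ᵥ w) = v ⬝ᵥ w ∧
      (AdMatrix U *ᵥ v) ⨯₃ (AdMatrix U *ᵥ w) = AdMatrix U *ᵥ (v ⨯₃ w) := by
  have hU' : U * Uᴴ = 1 := mul_eq_one_comm.1 hU
  have h1 := dotPauli_mul (AdMatrix U *ᵥ v) (AdMatrix U *ᵥ w)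
  have h2 : U * dotPauli v * Uᴴ * (U * dotPauli w * Uᴴ) = U * (dotPauli v * dotPauli w) * Uᴴ := by
    calc _ = U * dotPauli v * (Uᴴ * U) * dotPauli w * Uᴴ := by simp only [mul_assoc]
      _ = _ := by rw [hU, mul_one]; simp only [mul_assoc]
  rw [AdMatrix_spec hU, AdMatrix_spec hU, h2, dotPauli_mul, mul_add, add_mul, Matrix.mul_smul,
    Matrix.smul_mul, mul_one, hU', Matrix.mul_smul, Matrix.smul_mul, ← AdMatrix_spec hU] at h1
  have ht := congrArg Matrix.trace h1
  simp only [Matrix.trace_add, Matrix.trace_smul, dotPauli_trace, Matrix.trace_one] at ht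
  have hd : v ⬝ᵥ w = (AdMatrix U *ᵥ v) ⬝ᵥ (AdMatrix U *ᵥ w) := by
    simpa using ht
  refine ⟨hd.symm, ?_⟩
  rw [hd] at h1
  have h3 := smul_right_injective _ Complex.I_ne_zero (add_left_cancel h1)
  exact (dotPauli_injective h3).symm

theorem AdMatrix_mem (hU : Uᴴ * U = 1) :
    AdMatrix U ∈ Matrix.specialOrthogonalGroup (Fin 3) ℝ := by
  set A := AdMatrix U with hA
  have hcol : ∀ b, A *ᵥ Pi.single b 1 = fun c => A c b := fun b => by ext c; simp
  have ho : Aᵀ * A = 1 := by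
    ext i j
    have h := (AdMatrix_mul hU (Pi.single i 1) (Pi.single j 1)).1
    rw [← hA, hcol, hcol] at h
    rw [Matrix.mul_apply, Matrix.one_apply]
    simpa [dotProduct, Pi.single_apply, eq_comm] using h
  rw [Matrix.mem_specialOrthogonalGroup_iff, Matrix.mem_orthogonalGroup_iff']
  refine ⟨ho, ?_⟩
  have h := (AdMatrix_mul hU (Pi.single 0 1) (Pi.single 1 1)).2
  have hc : (Pi.single 0 1 : Fin 3 → ℝ) ⨯₃ Pi.single 1 1 = Pi.single 2 1 := by
    ext i; fin_cases i <;> simp [cross_apply]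
  rw [← hA, hc, hcol, hcol, hcol] at h
  have e := fun i => congrFun h i
  have e0 := e 0; have e1 := e 1; have e2 := e 2
  simp [cross_apply] at e0 e1 e2
  have e3 := congrFun (congrFun ho 2) 2
  simp [Matrix.mul_apply, Fin.sum_univ_three] at e3
  rw [Matrix.det_fin_three]
  linear_combination e3 + A 0 2 * e0 + A 1 2 * e1 + A 2 2 * e2

end

/-- The homomorphism `U ↦ Ad_U` from unitary matrices to rotations, which identifies `PU(2)` with
`SO(3)`. -/
def Ad (U : Matrix.unitaryGroup (Fin 2) ℂ) : SO3 :=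
  ⟨AdMatrix U.1, AdMatrix_mem (Matrix.mem_unitaryGroup_iff'.1 U.2)⟩

theorem scalar_of_commute {X : Matrix (Fin 2) (Fin 2) ℂ} (h : ∀ a, X * pauli a = pauli a * X) :
    X = X 0 0 • (1 : Matrix (Fin 2) (Fin 2) ℂ) := by
  have h0 := h 0
  have h2 := h 2
  have a := congrFun (congrFun h0 0) 1
  have b := congrFun (congrFun h2 0) 1
  have c := congrFun (congrFun h2 1) 0
  simp [pauli, Matrix.mul_apply, Fin.sum_univ_two] at a b c
  have b' : X 0 1 = 0 := by linear_combination (-1/2) * b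
  have c' : X 1 0 = 0 := by linear_combination (1/2) * c
  ext i j
  fin_cases i <;> fin_cases j <;> simp [a, b', c']

theorem exists_intertwiner (R : SO3) : ∃ V : Matrix (Fin 2) (Fin 2) ℂ, V ≠ 0 ∧
    ∀ b, dotPauli (fun c => R.1 c b) * V = V * pauli b := by
  set T : Fin 3 → Matrix (Fin 2) (Fin 2) ℂ := fun b => dotPauli (fun c => R.1 c b) with hT
  have hmem := Matrix.mem_specialOrthogonalGroup_iff.1 R.2
  have ho : R.1ᵀ * R.1 = 1 := (Matrix.mem_orthogonalGroup_iff' _ _).1 hmem.1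
  have hadj : R.1.adjugate = R.1ᵀ := by
    have : R.1 * R.1.adjugate = 1 := by rw [Matrix.mul_adjugate, hmem.2, one_smul]
    calc R.1.adjugate = R.1ᵀ * R.1 * R.1.adjugate := by rw [ho, one_mul]
      _ = R.1ᵀ := by rw [mul_assoc, this, mul_one]
  have hdot : ∀ a b, (fun c => R.1 c a) ⬝ᵥ (fun c => R.1 c b) = if a = b then 1 else 0 := by
    intro a b
    have := congrFun (congrFun ho a) b
    rwa [Matrix.mul_apply, Matrix.one_apply] at this
  have hcr : ∀ a b c : Fin 3, (a = 0 ∧ b = 1 ∧ c = 2) ∨ (a = 1 ∧ b = 2 ∧ c = 0) ∨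
      (a = 2 ∧ b = 0 ∧ c = 1) →
      (fun i => R.1 i a) ⨯₃ (fun i => R.1 i b) = fun i => R.1 i c := by
    intro a b c h
    ext i
    have e := congrFun (congrFun hadj c) i
    rw [Matrix.adjugate_fin_three] at e
    rcases h with ⟨rfl, rfl, rfl⟩ | ⟨rfl, rfl, rfl⟩ | ⟨rfl, rfl, rfl⟩ <;> fin_cases i <;>
      simp [cross_apply] at e ⊢ <;> linear_combination e
  have sq : ∀ a, T a * T a = 1 := by
    intro a
    simp only [hT]
    rw [dotPauli_mul, hdot, cross_self]
    simp [dotPauli]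
  have pr : ∀ a b c : Fin 3, (a = 0 ∧ b = 1 ∧ c = 2) ∨ (a = 1 ∧ b = 2 ∧ c = 0) ∨
      (a = 2 ∧ b = 0 ∧ c = 1) → T a * T b = Complex.I • T c ∧ T b * T a = -(Complex.I • T c) := by
    intro a b c h
    have hab : a ≠ b := by rcases h with ⟨rfl, rfl, rfl⟩ | ⟨rfl, rfl, rfl⟩ | ⟨rfl, rfl, rfl⟩ <;> decide
    have neg : ∀ v, dotPauli (-v) = -dotPauli v := fun v => by simp [dotPauli]
    simp only [hT]
    rw [dotPauli_mul, dotPauli_mul, hdot, hdot, if_neg hab, if_neg hab.symm, ← cross_anticomm (fun c => R.1 c a),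
      hcr a b c h, neg]
    simp
  have p01 : pauli 0 * pauli 1 = Complex.I • pauli 2 := by
    ext i j; fin_cases i <;> fin_cases j <;> simp [pauli, Matrix.mul_apply, Fin.sum_univ_two]
  have p10 : pauli 1 * pauli 0 = -(Complex.I • pauli 2) := by
    ext i j; fin_cases i <;> fin_cases j <;> simp [pauli, Matrix.mul_apply, Fin.sum_univ_two]
  have p12 : pauli 1 * pauli 2 = Complex.I • pauli 0 := by
    ext i j; fin_cases i <;> fin_cases j <;> simp [pauli, Matrix.mul_apply, Fin.sum_univ_two]
  have p21 : pauli 2 * pauli 1 = -(Complex.I • pauli 0) := by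
    ext i j; fin_cases i <;> fin_cases j <;> simp [pauli, Matrix.mul_apply, Fin.sum_univ_two]
  have p20 : pauli 2 * pauli 0 = Complex.I • pauli 1 := by
    ext i j; fin_cases i <;> fin_cases j <;> simp [pauli, Matrix.mul_apply, Fin.sum_univ_two]
  have p02 : pauli 0 * pauli 2 = -(Complex.I • pauli 1) := by
    ext i j; fin_cases i <;> fin_cases j <;> simp [pauli, Matrix.mul_apply, Fin.sum_univ_two]
  have psq : ∀ a, pauli a * pauli a = 1 := by
    intro a
    ext i j; fin_cases a <;> fin_cases i <;> fin_cases j <;>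
      simp [pauli, Matrix.mul_apply, Fin.sum_univ_two]
  let W : Matrix (Fin 2) (Fin 2) ℂ → Matrix (Fin 2) (Fin 2) ℂ := fun X =>
    X + T 0 * X * pauli 0 + T 1 * X * pauli 1 + T 2 * X * pauli 2
  obtain ⟨t01, t10⟩ := pr 0 1 2 (by simp)
  obtain ⟨t12, t21⟩ := pr 1 2 0 (by simp)
  obtain ⟨t20, t02⟩ := pr 2 0 1 (by simp)
  have hW : ∀ X b, T b * W X = W X * pauli b := by
    intro X b
    simp only [W, mul_add, add_mul]
    fin_cases b <;> simp only [Fin.zero_eta, Fin.mk_one, Fin.reduceFinMk] <;>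
      simp only [← mul_assoc, sq, t01, t10, t12, t21, t20, t02] <;>
      simp only [mul_assoc, psq, p01, p10, p12, p21, p20, p02] <;>
      simp <;> abel
  by_contra! hcon
  have hz : ∀ X, W X = 0 := fun X => by
    by_contra h
    obtain ⟨b, hb⟩ := hcon (W X) h
    exact hb (hW X b)
  have z00 := congrFun (congrFun (hz !![1, 0; 0, 0]) 0) 0
  have z01 := congrFun (congrFun (hz !![0, 1; 0, 0]) 0) 1
  have z10 := congrFun (congrFun (hz !![0, 0; 1, 0]) 1) 0
  have z11 := congrFun (congrFun (hz !![0, 0; 0, 1]) 1) 1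
  simp [W, hT, dotPauli_eq, pauli] at z00 z01 z10 z11
  have : (4 : ℂ) = 0 := by linear_combination z00 + z01 + z10 + z11
  norm_num at this

theorem Ad_surjective : Function.Surjective Ad := by
  intro R
  obtain ⟨V, hV0, hV⟩ := exists_intertwiner R
  have hV' : ∀ b, Vᴴ * dotPauli (fun c => R.1 c b) = pauli b * Vᴴ := fun b => by
    have := congrArg Matrix.conjTranspose (hV b)
    rwa [Matrix.conjTranspose_mul, Matrix.conjTranspose_mul, dotPauli_conjTranspose,
      ← dotPauli_single, dotPauli_conjTranspose, dotPauli_single] at this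
  have hs := scalar_of_commute (X := Vᴴ * V) fun b => by
    rw [mul_assoc, ← hV, ← mul_assoc, hV', mul_assoc]
  set r : ℝ := Complex.normSq (V 0 0) + Complex.normSq (V 1 0) with hr
  have hc : (Vᴴ * V) 0 0 = (r : ℂ) := by
    rw [Matrix.mul_apply, Fin.sum_univ_two, hr]
    simp [Complex.normSq_eq_conj_mul_self]
  rw [hc] at hs
  have hr0 : 0 < r := by
    refine lt_of_le_of_ne (add_nonneg (Complex.normSq_nonneg _) (Complex.normSq_nonneg _)) ?_
    intro h0
    rw [← h0] at hs
    have h00 : Complex.normSq (V 0 0) + Complex.normSq (V 1 0) = 0 := h0.symm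
    have h11 := congrFun (congrFun hs 1) 1
    simp [Matrix.mul_apply, Fin.sum_univ_two, ← Complex.normSq_eq_conj_mul_self] at h11
    have h11' : Complex.normSq (V 0 1) + Complex.normSq (V 1 1) = 0 := by exact_mod_cast h11
    have n := fun i j => Complex.normSq_nonneg (V i j)
    have z : ∀ i j, Complex.normSq (V i j) = 0 := by
      rw [Fin.forall_fin_two, Fin.forall_fin_two, Fin.forall_fin_two]
      refine ⟨⟨?_, ?_⟩, ?_, ?_⟩ <;> linarith [n 0 0, n 0 1, n 1 0, n 1 1]
    exact hV0 (Matrix.ext fun i j => Complex.normSq_eq_zero.1 (z i j))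
  set s : ℂ := (((Real.sqrt r)⁻¹ : ℝ) : ℂ) with hsdef
  have hss : s * s * r = 1 := by
    rw [hsdef]
    norm_cast
    have := Real.mul_self_sqrt hr0.le
    have h3 : Real.sqrt r ≠ 0 := (Real.sqrt_pos.2 hr0).ne'
    field_simp
    nlinarith
  have hstar : star s = s := Complex.conj_ofReal _
  have hU : (s • V)ᴴ * (s • V) = 1 := by
    rw [Matrix.conjTranspose_smul, hstar, Matrix.smul_mul, Matrix.mul_smul, hs, smul_smul,
      smul_smul, hss, one_smul]
  refine ⟨⟨s • V, Matrix.mem_unitaryGroup_iff'.2 hU⟩, Subtype.ext ?_⟩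
  ext c b
  have h1 := AdMatrix_pauli hU b
  have h2 : s • V * pauli b * (s • V)ᴴ = dotPauli (fun c => R.1 c b) := by
    rw [Matrix.smul_mul, ← hV, ← Matrix.mul_smul, mul_assoc, mul_eq_one_comm.1 hU, mul_one]
  rw [h2] at h1
  exact congrFun (dotPauli_injective h1) c

/-- The positive Hermitian matrix `Λ 1 + λ · τ`, where `Λ = √(1 + |λ|²)`. -/
def boost (l : Fin 3 → ℝ) : Matrix (Fin 2) (Fin 2) ℂ :=
  (Real.sqrt (1 + l ⬝ᵥ l) : ℂ) • (1 : Matrix (Fin 2) (Fin 2) ℂ) + dotPauli l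

theorem one_add_pos (l : Fin 3 → ℝ) : 0 < 1 + l ⬝ᵥ l := by
  have : 0 ≤ l ⬝ᵥ l := Finset.sum_nonneg fun i _ => mul_self_nonneg _
  linarith

theorem boost_sq (l : Fin 3 → ℝ) : boost l * boost l =
    ((1 + 2 * (l ⬝ᵥ l) : ℝ) : ℂ) • (1 : Matrix (Fin 2) (Fin 2) ℂ) +
      ((2 * Real.sqrt (1 + l ⬝ᵥ l) : ℝ) : ℂ) • dotPauli l := by
  have h : (Real.sqrt (1 + l ⬝ᵥ l) : ℂ) * Real.sqrt (1 + l ⬝ᵥ l) = 1 + (l ⬝ᵥ l : ℝ) := by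
    have := Real.mul_self_sqrt (one_add_pos l).le
    exact_mod_cast this
  have hd := dotPauli_mul l l
  rw [cross_self] at hd
  simp only [boost, add_mul, mul_add, hd, Matrix.smul_mul, Matrix.mul_smul, one_mul, mul_one,
    smul_smul, h]
  have : dotPauli 0 = 0 := by simp [dotPauli]
  rw [this]
  push_cast
  module

theorem boost_det (l : Fin 3 → ℝ) : (boost l).det = 1 := by
  have h : (Real.sqrt (1 + l ⬝ᵥ l) : ℂ) * Real.sqrt (1 + l ⬝ᵥ l) = 1 + (l ⬝ᵥ l : ℝ) := by
    have := Real.mul_self_sqrt (one_add_pos l).le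
    exact_mod_cast this
  have e : ((l ⬝ᵥ l : ℝ) : ℂ) = l 0 * l 0 + l 1 * l 1 + l 2 * l 2 := by
    simp [dotProduct, Fin.sum_univ_three]
  rw [e] at h
  rw [boost, dotPauli_eq, Matrix.det_fin_two]
  simp
  linear_combination h + (l 1 : ℂ) ^ 2 * Complex.I_sq

theorem boost_conjTranspose (l : Fin 3 → ℝ) : (boost l)ᴴ = boost l := by
  rw [boost, Matrix.conjTranspose_add, dotPauli_conjTranspose, Matrix.conjTranspose_smul,
    Matrix.conjTranspose_one]
  congr 2
  exact Complex.conj_ofReal _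

theorem boost_sq_injective {l m : Fin 3 → ℝ} (h : boost l * boost l = boost m * boost m) :
    l = m := by
  rw [boost_sq, boost_sq] at h
  have ht := congrArg Matrix.trace h
  simp only [Matrix.trace_add, Matrix.trace_smul, dotPauli_trace, Matrix.trace_one] at ht
  have hd : l ⬝ᵥ l = m ⬝ᵥ m := by
    have : ((1 + 2 * (l ⬝ᵥ l) : ℝ) : ℂ) = ((1 + 2 * (m ⬝ᵥ m) : ℝ) : ℂ) := by simpa using ht
    have := Complex.ofReal_injective this
    linarith
  rw [hd] at h
  have h2 := add_left_cancel h
  have hne : ((2 * Real.sqrt (1 + m ⬝ᵥ m) : ℝ) : ℂ) ≠ 0 := by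
    have := Real.sqrt_pos.2 (one_add_pos m)
    exact Complex.ofReal_ne_zero.2 (by positivity)
  exact dotPauli_injective (smul_right_injective _ hne h2)

/-- `Λ 1 + λ · τ` as an invertible matrix. -/
def boostGL (l : Fin 3 → ℝ) : GL (Fin 2) ℂ :=
  Matrix.GeneralLinearGroup.mkOfDetNeZero (boost l) (by rw [boost_det]; exact one_ne_zero)

/-- A unitary matrix inducing a given rotation. -/
def lift (R : SO3) : Matrix.unitaryGroup (Fin 2) ℂ := Function.surjInv Ad_surjective R

theorem Ad_lift (R : SO3) : Ad (lift R) = R := Function.surjInv_eq _ R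

/-- The map `([U], λ) ↦ [U (Λ 1 + λ · τ)]`, with `[U]` identified with the rotation `Ad_U`. -/
def polarFun (x : SO3 × (Fin 3 → ℝ)) : Rat1 :=
  cls (Unitary.toUnits (lift x.1)) * cls (boostGL x.2)

theorem Ad_eq_iff {U V : Matrix.unitaryGroup (Fin 2) ℂ} :
    Ad U = Ad V ↔ ∃ c : ℂ, c ≠ 0 ∧ V.1 = c • U.1 := by
  have hU := Matrix.mem_unitaryGroup_iff'.1 U.2
  have hV := Matrix.mem_unitaryGroup_iff'.1 V.2
  simp only [Matrix.star_eq_conjTranspose] at hU hV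
  have hU' : U.1 * U.1ᴴ = 1 := mul_eq_one_comm.1 hU
  have hV' : V.1 * V.1ᴴ = 1 := mul_eq_one_comm.1 hV
  constructor
  · intro h
    have hA : AdMatrix U.1 = AdMatrix V.1 := congrArg Subtype.val h
    have hp : ∀ b, U.1 * pauli b * U.1ᴴ = V.1 * pauli b * V.1ᴴ := fun b => by
      rw [← AdMatrix_pauli hU, ← AdMatrix_pauli hV, hA]
    have hc := scalar_of_commute (X := U.1ᴴ * V.1) fun b => by
      calc U.1ᴴ * V.1 * pauli b = U.1ᴴ * (V.1 * pauli b * V.1ᴴ) * V.1 := by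
            simp only [mul_assoc, hV, mul_one]
        _ = U.1ᴴ * (U.1 * pauli b * U.1ᴴ) * V.1 := by rw [hp]
        _ = (U.1ᴴ * U.1) * (pauli b * (U.1ᴴ * V.1)) := by simp only [mul_assoc]
        _ = _ := by rw [hU, one_mul]
    set c := (U.1ᴴ * V.1) 0 0
    have hVc : V.1 = c • U.1 := by
      calc V.1 = U.1 * U.1ᴴ * V.1 := by rw [hU', one_mul]
        _ = U.1 * (U.1ᴴ * V.1) := mul_assoc _ _ _
        _ = c • U.1 := by rw [hc, Matrix.mul_smul, mul_one]
    refine ⟨c, ?_, hVc⟩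
    intro h0
    rw [h0, zero_smul] at hVc
    rw [hVc] at hV
    simp at hV
  · rintro ⟨c, hc0, hc⟩
    have hcc : c * star c = 1 := by
      rw [hc, Matrix.conjTranspose_smul, Matrix.smul_mul, Matrix.mul_smul, hU', smul_smul] at hV'
      simpa using congrFun (congrFun hV' 0) 0
    refine Subtype.ext ?_
    change AdMatrix U.1 = AdMatrix V.1
    ext i j
    simp only [AdMatrix, Matrix.of_apply]
    rw [hc, Matrix.conjTranspose_smul, Matrix.smul_mul, Matrix.smul_mul, Matrix.mul_smul,
      smul_smul, hcc, one_smul]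

theorem cls_unitary_eq_iff {U V : Matrix.unitaryGroup (Fin 2) ℂ} :
    cls (Unitary.toUnits U) = cls (Unitary.toUnits V) ↔ Ad U = Ad V := by
  rw [Ad_eq_iff, cls_eq_cls]
  rfl

/-- The defining property of the polar parametrization, for every choice of the unitary matrix. -/
theorem polarFun_Ad (U : Matrix.unitaryGroup (Fin 2) ℂ) (l : Fin 3 → ℝ) :
    polarFun (Ad U, l) = cls (Unitary.toUnits U) * cls (boostGL l) := by
  rw [polarFun, cls_unitary_eq_iff.2 (Ad_lift (Ad U))]

theorem polarFun_injective : Function.Injective polarFun := by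
  rintro ⟨R, l⟩ ⟨S, m⟩ h
  obtain ⟨U, rfl⟩ := Ad_surjective R
  obtain ⟨V, rfl⟩ := Ad_surjective S
  rw [polarFun_Ad, polarFun_Ad] at h
  have h' := h
  rw [← map_mul, ← map_mul] at h'
  obtain ⟨c, hc0, hc⟩ := cls_eq_cls.1 h'
  replace hc : V.1 * boost m = c • (U.1 * boost l) := hc
  have hU := Matrix.mem_unitaryGroup_iff'.1 U.2
  have hV := Matrix.mem_unitaryGroup_iff'.1 V.2
  simp only [Matrix.star_eq_conjTranspose] at hU hV
  have hX : ∀ (W : Matrix (Fin 2) (Fin 2) ℂ) (k : Fin 3 → ℝ), Wᴴ * W = 1 →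
      (W * boost k)ᴴ * (W * boost k) = boost k * boost k := fun W k hW => by
    rw [Matrix.conjTranspose_mul, boost_conjTranspose]
    calc _ = boost k * (Wᴴ * W) * boost k := by simp only [mul_assoc]
      _ = _ := by rw [hW, mul_one]
  have h1 := hX V.1 m hV
  rw [hc, Matrix.conjTranspose_smul, Matrix.smul_mul, Matrix.mul_smul, hX U.1 l hU, smul_smul] at h1
  have hcc : star c * c = ((Complex.normSq c : ℝ) : ℂ) := (Complex.normSq_eq_conj_mul_self).symm
  have hd := congrArg Matrix.det h1
  rw [Matrix.det_smul, Matrix.det_mul, Matrix.det_mul, boost_det, boost_det, hcc] at hd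
  have hn : Complex.normSq c = 1 := by
    have : (Complex.normSq c) ^ 2 = 1 := by
      have : ((Complex.normSq c ^ 2 : ℝ) : ℂ) = ((1 : ℝ) : ℂ) := by simpa using hd
      exact Complex.ofReal_injective this
    nlinarith [Complex.normSq_nonneg c]
  rw [hcc, hn, Complex.ofReal_one, one_smul] at h1
  have hl : l = m := boost_sq_injective h1
  subst hl
  have hR := cls_unitary_eq_iff.1 (mul_right_cancel h)
  rw [hR]

theorem polarFun_surjective : Function.Surjective polarFun := by
  intro p
  obtain ⟨L, rfl⟩ := Matrix.ProjGenLinGroup.mk_surjective p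
  have hL : L.1.det ≠ 0 := (L.1.isUnit_iff_isUnit_det.1 L.isUnit).ne_zero
  obtain ⟨d, hd⟩ := IsAlgClosed.exists_pow_nat_eq L.1.det (n := 2) (by norm_num)
  have hd0 : d ≠ 0 := by
    rintro rfl
    exact hL (by rw [← hd]; norm_num)
  set M : Matrix (Fin 2) (Fin 2) ℂ := d⁻¹ • L.1 with hM
  have hMdet : M.det = 1 := by
    rw [hM, Matrix.det_smul, ← hd, Fintype.card_fin, ← mul_pow, inv_mul_cancel₀ hd0, one_pow]
  have hLM : L.1 = d • M := by rw [hM, smul_smul, mul_inv_cancel₀ hd0, one_smul]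
  set P := Mᴴ * M with hP
  have hPdet : P.det = 1 := by
    rw [hP, Matrix.det_mul, Matrix.det_conjTranspose, hMdet, star_one, one_mul]
  have hPh : Pᴴ = P := by
    rw [hP, Matrix.conjTranspose_mul, Matrix.conjTranspose_conjTranspose]
  set t : ℝ := Complex.normSq (M 0 0) + Complex.normSq (M 1 0) + Complex.normSq (M 0 1) +
    Complex.normSq (M 1 1) with ht
  have ht0 : 0 < t + 2 := by
    have n := fun i j => Complex.normSq_nonneg (M i j)
    linarith [n 0 0, n 0 1, n 1 0, n 1 1]
  have hPtr : P.trace = (t : ℂ) := by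
    rw [hP, ht, Matrix.trace_fin_two]
    simp only [Matrix.mul_apply, Fin.sum_univ_two, Matrix.conjTranspose_apply, Complex.ofReal_add,
      Complex.normSq_eq_conj_mul_self, starRingEnd_apply]
    ring
  have hCH : P * P = (t : ℂ) • P - 1 := by
    rw [← hPtr]
    rw [Matrix.det_fin_two] at hPdet
    ext i j
    fin_cases i <;> fin_cases j <;>
      simp [Matrix.mul_apply, Fin.sum_univ_two, Matrix.trace_fin_two] <;>
      first | linear_combination (-1 : ℂ) * hPdet | ring
  set s : ℝ := Real.sqrt (t + 2) with hs
  have hs0 : 0 < s := Real.sqrt_pos.2 ht0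
  have hsC : (s : ℂ) ≠ 0 := Complex.ofReal_ne_zero.2 hs0.ne'
  have hss : (s : ℂ) * s = t + 2 := by
    have := Real.mul_self_sqrt ht0.le
    exact_mod_cast this
  set H : Matrix (Fin 2) (Fin 2) ℂ := (s : ℂ)⁻¹ • (P + 1) with hH
  have hHH : H * H = P := by
    have e : (P + 1) * (P + 1) = ((s : ℂ) * s) • P := by
      rw [hss, add_mul, mul_add, hCH]
      simp only [one_mul, mul_one]
      module
    rw [hH, Matrix.smul_mul, Matrix.mul_smul, e, smul_smul, smul_smul]
    field_simp
    simp
  have hHh : Hᴴ = H := by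
    rw [hH, Matrix.conjTranspose_smul, Matrix.conjTranspose_add, hPh, Matrix.conjTranspose_one]
    congr 1
    simp
  have hHtr : H.trace = s := by
    rw [hH, Matrix.trace_smul, Matrix.trace_add, hPtr, Matrix.trace_one, Fintype.card_fin,
      smul_eq_mul]
    field_simp
    rw [sq, hss]; norm_num
  have hHdet : H.det = 1 := by
    have e : (P + 1).det = t + 2 := by
      rw [Matrix.det_fin_two] at hPdet ⊢
      rw [Matrix.trace_fin_two] at hPtr
      simp
      linear_combination hPdet + hPtr
    rw [hH, Matrix.det_smul, e, ← hss, Fintype.card_fin]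
    field_simp
  obtain ⟨l, hl⟩ : ∃ l, dotPauli l = H - ((s / 2 : ℝ) : ℂ) • 1 := by
    refine ⟨_, dotPauli_pauliCoord ?_ ?_⟩
    · rw [Matrix.conjTranspose_sub, hHh, Matrix.conjTranspose_smul, Matrix.conjTranspose_one]
      congr 2
      exact Complex.conj_ofReal _
    · rw [Matrix.trace_sub, hHtr, Matrix.trace_smul, Matrix.trace_one]
      simp
  have hHl : H = ((s / 2 : ℝ) : ℂ) • 1 + dotPauli l := by rw [hl]; abel
  have hsl : Real.sqrt (1 + l ⬝ᵥ l) = s / 2 := by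
    have h1 := hHdet
    rw [hHl, dotPauli_eq, Matrix.det_fin_two] at h1
    have h2 := congrArg Complex.re h1
    simp at h2
    have e : l ⬝ᵥ l = l 0 * l 0 + l 1 * l 1 + l 2 * l 2 := by
      simp [dotProduct, Fin.sum_univ_three]
    rw [e, Real.sqrt_eq_iff_mul_self_eq_of_pos (by positivity)]
    linarith
  have hHb : H = boost l := by rw [boost, hsl, hHl]
  have hHu : IsUnit H.det := by rw [hHdet]; exact isUnit_one
  have hU : (M * H⁻¹)ᴴ * (M * H⁻¹) = 1 := by
    rw [Matrix.conjTranspose_mul, Matrix.conjTranspose_nonsing_inv, hHh]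
    calc H⁻¹ * Mᴴ * (M * H⁻¹) = H⁻¹ * (Mᴴ * M) * H⁻¹ := by simp only [mul_assoc]
      _ = (H⁻¹ * H) * (H * H⁻¹) := by rw [← hP, ← hHH]; simp only [mul_assoc]
      _ = 1 := by rw [Matrix.nonsing_inv_mul _ hHu, Matrix.mul_nonsing_inv _ hHu, one_mul]
  refine ⟨(Ad ⟨M * H⁻¹, Matrix.mem_unitaryGroup_iff'.2 hU⟩, l), ?_⟩
  rw [polarFun_Ad, ← map_mul]
  refine cls_eq_cls.2 ⟨d, hd0, ?_⟩
  change L.1 = d • (M * H⁻¹ * boost l)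
  rw [← hHb, Matrix.nonsing_inv_mul_cancel_right _ _ hHu, hLM]

/-- The polar decomposition: rational maps of degree one correspond to `SO(3) × ℝ³`. -/
def polar : SO3 × (Fin 3 → ℝ) ≃ Rat1 :=
  Equiv.ofBijective polarFun ⟨polarFun_injective, polarFun_surjective⟩

/-! ### The tangent bundle of `SO(3)` -/

/-- The tangent bundle of `SO(3)`: a rotation `R` and a matrix `X` tangent to `SO(3)` at `R`, that
is, such that `R⁻¹ X` is skew-symmetric. -/
@[ext]
structure TSO3 where
  base : SO3
  vec : Matrix (Fin 3) (Fin 3) ℝ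
  tangent : (base.1⁻¹ * vec)ᵀ = -(base.1⁻¹ * vec)

/-- The value `∑ λ_a θ_a` at the identity of the left-invariant fields `θ_a` corresponding to the
basis `(i/2) τ_a` of `su(2)` under `U ↦ Ad_U`: the matrix of `ad (∑ λ_a (i/2) τ_a)` in that basis. -/
def so3Vec (l : Fin 3 → ℝ) : Matrix (Fin 3) (Fin 3) ℝ :=
  !![0, l 2, -l 1; -l 2, 0, l 0; l 1, -l 0, 0]

theorem so3Vec_ad (a b : Fin 3) : ⁅su2Basis a, su2Basis b⁆ =
    ∑ c, (so3Vec (Pi.single a 1) c b : ℂ) • su2Basis c := by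
  fin_cases a <;> fin_cases b <;> ext i j <;> fin_cases i <;> fin_cases j <;>
    simp [Ring.lie_def, su2Basis, pauli, so3Vec, Fin.sum_univ_three, Complex.ext_iff] <;> norm_num

theorem SO3.inv_eq (R : SO3) : R.1⁻¹ = R.1ᵀ :=
  Matrix.inv_eq_left_inv ((Matrix.mem_orthogonalGroup_iff' _ _).1
    (Matrix.mem_specialOrthogonalGroup_iff.1 R.2).1)

theorem SO3.inv_mul (R : SO3) : R.1⁻¹ * R.1 = 1 := by
  rw [SO3.inv_eq]
  exact (Matrix.mem_orthogonalGroup_iff' _ _).1 (Matrix.mem_specialOrthogonalGroup_iff.1 R.2).1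

theorem SO3.mul_inv (R : SO3) : R.1 * R.1⁻¹ = 1 := mul_eq_one_comm.1 (SO3.inv_mul R)

theorem SO3.coe_inv (R : SO3) : (R⁻¹ : SO3).1 = R.1⁻¹ := by
  rw [SO3.inv_eq]; rfl

/-- The identification `(R, λ) ↦ (λ · θ)(R)` of `SO(3) × ℝ³` with the tangent bundle, by
left-invariant vector fields. -/
def leftTriv : SO3 × (Fin 3 → ℝ) ≃ TSO3 where
  toFun x := ⟨x.1, x.1.1 * so3Vec x.2, by
    rw [← mul_assoc, SO3.inv_mul, one_mul]
    ext i j; fin_cases i <;> fin_cases j <;> simp [so3Vec]⟩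
  invFun X := (X.base, ![(X.base.1⁻¹ * X.vec) 1 2, (X.base.1⁻¹ * X.vec) 2 0,
    (X.base.1⁻¹ * X.vec) 0 1])
  left_inv x := by
    simp only [← mul_assoc, SO3.inv_mul, one_mul]
    refine Prod.ext rfl ?_
    ext i; fin_cases i <;> simp [so3Vec]
  right_inv X := by
    refine TSO3.ext rfl ?_
    have h := fun i j => congrFun (congrFun X.tangent i) j
    have key : so3Vec ![(X.base.1⁻¹ * X.vec) 1 2, (X.base.1⁻¹ * X.vec) 2 0,
        (X.base.1⁻¹ * X.vec) 0 1] = X.base.1⁻¹ * X.vec := by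
      generalize X.base.1⁻¹ * X.vec = Y at h
      simp only [Matrix.transpose_apply, Matrix.neg_apply] at h
      ext i j
      fin_cases i <;> fin_cases j <;> simp [so3Vec] <;>
        linarith [h 0 0, h 1 1, h 2 2, h 0 1, h 0 2, h 1 2]
    change X.base.1 * so3Vec _ = X.vec
    rw [key, ← mul_assoc, SO3.mul_inv, one_mul]

theorem fderiv_inv (R : SO3) (X : Matrix (Fin 3) (Fin 3) ℝ) :
    fderiv ℝ (fun M : Matrix (Fin 3) (Fin 3) ℝ => M⁻¹) R.1 X = -(R.1⁻¹ * X * R.1⁻¹) := by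
  let : NormedRing (Matrix (Fin 3) (Fin 3) ℝ) := Matrix.linftyOpNormedRing
  let : NormedAlgebra ℝ (Matrix (Fin 3) (Fin 3) ℝ) := Matrix.linftyOpNormedAlgebra
  have hu : IsUnit R.1 := ⟨⟨R.1, R.1⁻¹, SO3.mul_inv R, SO3.inv_mul R⟩, rfl⟩
  have h := hasFDerivAt_ringInverse (𝕜 := ℝ) hu.unit
  have h2 : (fun M : Matrix (Fin 3) (Fin 3) ℝ => M⁻¹) = Ring.inverse := by
    ext1 M; exact Matrix.nonsing_inv_eq_ringInverse M
  rw [h2]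
  have h3 := congrArg (fun F => F X) h.fderiv
  have h4 : ((hu.unit⁻¹ : (Matrix (Fin 3) (Fin 3) ℝ)ˣ) : Matrix (Fin 3) (Fin 3) ℝ) = R.1⁻¹ := by
    rw [Matrix.coe_units_inv]; rfl
  simp only [h4] at h3
  exact h3

/-- The differential `df` of the inversion `f(R) = R⁻¹` of `SO(3)`. -/
def dInv (X : TSO3) : TSO3 where
  base := X.base⁻¹
  vec := fderiv ℝ (fun M : Matrix (Fin 3) (Fin 3) ℝ => M⁻¹) X.base.1 X.vec
  tangent := by
    have h := X.tangent
    have h2 : X.vec = X.base.1 * (X.base.1⁻¹ * X.vec) := by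
      rw [← mul_assoc, SO3.mul_inv, one_mul]
    rw [fderiv_inv, SO3.coe_inv, SO3.inv_eq]
    rw [SO3.inv_eq] at h h2
    rw [← Matrix.transpose_nonsing_inv, SO3.inv_eq, Matrix.transpose_transpose]
    generalize hY : X.base.1ᵀ * X.vec = Y at h h2
    have e : X.base.1 * -(Y * X.base.1ᵀ) = -(X.base.1 * Y * X.base.1ᵀ) := by
      rw [mul_neg, mul_assoc]
    rw [e, Matrix.transpose_neg, Matrix.transpose_mul, Matrix.transpose_mul,
      Matrix.transpose_transpose, h, neg_mul, mul_neg, mul_assoc]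

/-- The identification of the tangent bundle of `SO(3)` with the space of rational maps. -/
def identification : TSO3 ≃ Rat1 := leftTriv.symm.trans polar

end RatOne

/-!
The map in question is the group inversion `p ↦ p⁻¹` of `PGL(2, ℂ)`: in the polar parametrization
`p = [U (Λ + λ · τ)]`, the point `(R⁻¹, -R λ)` is `[U⁻¹ (Λ - (R λ) · τ)] = [(Λ - λ · τ) U⁻¹] = p⁻¹`
(`polarFun_inv`, `identification_dInv`). Inversion, transposition and the unitary action are all
given by complex linear maps of the four coefficients (`Induces`), hence are analytic.

To see that inversion preserves an invariant Kähler metric, it suffices to look at the diagonal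
points `[diag (1, s)]`, `s > 0`, since every point is moved to one of them by the unitary action
(`exists_act_diagPt`); and inversion may be replaced by transposition, which differs from it by a
conjugation. In the chart `[[1, x], [y, z]]` transposition exchanges `x` and `y`. At the point
`(0, 0, s)` the metric is Hermitian and invariant under conjugation by `diag (i, 1)`, so it is
`h_x |dx|² + h_y |dy|² + h_z |dz|²`, and what remains is `h_x = h_y` (`bilin_swap`).

This is where closedness of the Kähler form `ω` enters. Let `X`, `Y` be the Killing fields of the
conjugation action generated by `!![0, β; -conj β, 0]` for `β = 1` and `β = i`. Closedness together
with the Killing equations (`killing`) gives `d (ω (X, Y)) = ± ω ([X, Y], ·)`, and `[X, Y]`, which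
generates conjugation by diagonal matrices, vanishes at diagonal points. So `ω (X, Y)` is constant
along the diagonal (`hasDerivAt_form_orbit`), and it is zero because `X` and `Y` vanish at the
identity. At `(0, 0, s)` it equals `(s - 1)² (h_x - h_y)`; this gives `h_x = h_y` for `s ≠ 1`, and
for `s = 1` by continuity (`form_orbit_eq_zero`).
-/

namespace RatOne

/-! ### The differential of the inversion is the inversion of `PGL(2, ℂ)` -/

theorem so3Vec_mulVec (l v : Fin 3 → ℝ) : so3Vec l *ᵥ v = v ⨯₃ l := by
  ext i
  fin_cases i <;> simp [so3Vec, cross_apply, Matrix.mulVec, dotProduct, Fin.sum_univ_three] <;> ring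

/-- Rotations preserve the cross product, so `so3Vec` intertwines `R` with conjugation by `R`. -/
theorem so3Vec_rotate (R : SO3) (l : Fin 3 → ℝ) :
    so3Vec (R.1 *ᵥ l) * R.1 = R.1 * so3Vec l := by
  obtain ⟨U, rfl⟩ := Ad_surjective R
  refine Matrix.ext_of_mulVec_single fun i => ?_
  rw [← Matrix.mulVec_mulVec, ← Matrix.mulVec_mulVec, so3Vec_mulVec, so3Vec_mulVec]
  exact (AdMatrix_mul (Matrix.mem_unitaryGroup_iff'.1 U.2) _ _).2

theorem dInv_leftTriv (R : SO3) (l : Fin 3 → ℝ) :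
    dInv (leftTriv (R, l)) = leftTriv (R⁻¹, -(R.1 *ᵥ l)) := by
  refine TSO3.ext rfl ?_
  change fderiv ℝ (fun M : Matrix (Fin 3) (Fin 3) ℝ => M⁻¹) R.1 (R.1 * so3Vec l) =
    (R⁻¹ : SO3).1 * so3Vec (-(R.1 *ᵥ l))
  have hneg : ∀ m, so3Vec (-m) = -so3Vec m := fun m => by
    ext i j; fin_cases i <;> fin_cases j <;> simp [so3Vec]
  have h : so3Vec (R.1 *ᵥ l) = R.1 * so3Vec l * R.1⁻¹ := by
    rw [← so3Vec_rotate, mul_assoc, SO3.mul_inv, mul_one]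
  rw [fderiv_inv, SO3.coe_inv, hneg, mul_neg, h]
  simp only [mul_assoc]

theorem Ad_inv (U : Matrix.unitaryGroup (Fin 2) ℂ) : Ad U⁻¹ = (Ad U)⁻¹ := by
  have hU := Matrix.mem_unitaryGroup_iff'.1 U.2
  have hU' := Matrix.mem_unitaryGroup_iff.1 U.2
  rw [Matrix.star_eq_conjTranspose] at hU hU'
  refine eq_inv_of_mul_eq_one_right (Subtype.ext ?_)
  change AdMatrix U.1 * AdMatrix U.1ᴴ = 1
  refine Matrix.ext_of_mulVec_single fun i => dotPauli_injective ?_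
  rw [← Matrix.mulVec_mulVec, AdMatrix_spec hU, AdMatrix_spec (by simpa using hU'),
    Matrix.conjTranspose_conjTranspose, Matrix.one_mulVec, ← mul_assoc, ← mul_assoc, hU', one_mul,
    mul_assoc, hU', mul_one]

theorem boost_neg_mul (l : Fin 3 → ℝ) : boost (-l) * boost l = 1 := by
  have h : (Real.sqrt (1 + l ⬝ᵥ l) : ℂ) * Real.sqrt (1 + l ⬝ᵥ l) = 1 + (l ⬝ᵥ l : ℝ) := by
    have := Real.mul_self_sqrt (one_add_pos l).le
    exact_mod_cast this
  have hn : dotPauli (-l) = -dotPauli l := by simp [dotPauli]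
  have h0 : dotPauli 0 = 0 := by simp [dotPauli]
  have hd := dotPauli_mul l l
  rw [cross_self, h0] at hd
  simp only [boost, neg_dotProduct_neg, hn, add_mul, mul_add, Matrix.smul_mul, Matrix.mul_smul,
    one_mul, mul_one, smul_smul, h, neg_mul, hd]
  module

theorem boost_Ad (U : Matrix.unitaryGroup (Fin 2) ℂ) (l : Fin 3 → ℝ) :
    boost ((Ad U).1 *ᵥ l) = U.1 * boost l * U.1ᴴ := by
  have hU := Matrix.mem_unitaryGroup_iff'.1 U.2
  have hU' := Matrix.mem_unitaryGroup_iff.1 U.2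
  rw [Matrix.star_eq_conjTranspose] at hU hU'
  change boost (AdMatrix U.1 *ᵥ l) = _
  rw [boost, AdMatrix_spec hU, (AdMatrix_mul hU l l).1, boost, mul_add, add_mul, Matrix.mul_smul,
    Matrix.smul_mul, mul_one, hU']

/-- In the polar parametrization `p = [U (Λ + λ · τ)]` the point `(R⁻¹, -R λ)` is `p⁻¹`, because
`(Λ + λ · τ)⁻¹ = Λ - λ · τ` and `U (Λ - λ · τ) U⁻¹ = Λ - (R λ) · τ`. -/
theorem polarFun_inv (R : SO3) (l : Fin 3 → ℝ) :
    polarFun (R⁻¹, -(R.1 *ᵥ l)) = (polarFun (R, l))⁻¹ := by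
  obtain ⟨U, rfl⟩ := Ad_surjective R
  have hU := Matrix.mem_unitaryGroup_iff'.1 U.2
  rw [Matrix.star_eq_conjTranspose] at hU
  rw [← Ad_inv, polarFun_Ad, polarFun_Ad, ← map_mul, ← map_mul, ← map_inv]
  congr 1
  refine eq_inv_of_mul_eq_one_left (Units.ext ?_)
  change U.1ᴴ * boost (-((Ad U).1 *ᵥ l)) * (U.1 * boost l) = 1
  rw [← Matrix.mulVec_neg, boost_Ad]
  calc _ = (U.1ᴴ * U.1) * boost (-l) * (U.1ᴴ * U.1) * boost l := by simp only [mul_assoc]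
    _ = 1 := by rw [hU, one_mul, mul_one, boost_neg_mul]

theorem identification_dInv : identification ∘ dInv ∘ identification.symm = fun p => p⁻¹ := by
  ext1 p
  obtain ⟨X, rfl⟩ := identification.surjective p
  obtain ⟨⟨R, l⟩, rfl⟩ := leftTriv.surjective X
  rw [Function.comp_apply, Function.comp_apply, Equiv.symm_apply_apply, dInv_leftTriv]
  simp only [identification, Equiv.trans_apply, Equiv.symm_apply_apply]
  exact polarFun_inv R l

/-! ### Maps induced by linear maps of the coefficients -/

/-- The self-map `f` of the space of rational maps is given on coefficient vectors
`(a₁, a₂, a₃, a₄)` by the linear map `Λ`. -/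
def Induces (Λ : (Fin 4 → ℂ) →ₗ[ℂ] (Fin 4 → ℂ)) (f : Rat1 → Rat1) : Prop :=
  ∀ L : GL (Fin 2) ℂ, ∃ M : GL (Fin 2) ℂ, f (cls L) = cls M ∧ coeffs M.1 = Λ (coeffs L.1)

/-- A map given by `Λ` on coefficients, read in the charts `i` and `j`. -/
def chartMap (Λ : (Fin 4 → ℂ) →ₗ[ℂ] (Fin 4 → ℂ)) (i j : Fin 4) (q : C3) : C3 := fun k =>
  Λ (i.insertNth 1 q) (j.succAbove k) / Λ (i.insertNth 1 q) j

section
variable {Λ : (Fin 4 → ℂ) →ₗ[ℂ] (Fin 4 → ℂ)} {f : Rat1 → Rat1}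

theorem Induces.mem_chartDom (h : Induces Λ f) {i j : Fin 4} {q : C3} (hq : q ∈ chartRange i) :
    f (chartInv i q) ∈ chartDom j ↔ Λ (i.insertNth 1 q) j ≠ 0 := by
  replace hq := mem_chartRange.1 hq
  rw [chartInv_of_mem hq]
  obtain ⟨M, hM, hc⟩ := h (Matrix.GeneralLinearGroup.mkOfDetNeZero _ hq)
  rw [hM, mem_chartDom_cls, hc, coeffs_mkOfDetNeZero]

theorem Induces.chartFun_eq (h : Induces Λ f) {i j : Fin 4} {q : C3} (hq : q ∈ chartRange i) :
    chartFun j (f (chartInv i q)) = chartMap Λ i j q := by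
  replace hq := mem_chartRange.1 hq
  rw [chartInv_of_mem hq]
  obtain ⟨M, hM, hc⟩ := h (Matrix.GeneralLinearGroup.mkOfDetNeZero _ hq)
  ext k
  rw [hM, chartFun_cls, hc, coeffs_mkOfDetNeZero, chartMap]

theorem Induces.chartInv_chartMap (h : Induces Λ f) {i j : Fin 4} {q : C3} (hq : q ∈ chartRange i)
    (hj : Λ (i.insertNth 1 q) j ≠ 0) : chartInv j (chartMap Λ i j q) = f (chartInv i q) := by
  rw [← h.chartFun_eq hq, chartInv_chartFun ((h.mem_chartDom hq).2 hj)]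

theorem Induces.chartMap_mem (h : Induces Λ f) {i j : Fin 4} {q : C3} (hq : q ∈ chartRange i)
    (hj : Λ (i.insertNth 1 q) j ≠ 0) : chartMap Λ i j q ∈ chartRange j := by
  rw [← h.chartFun_eq hq]
  exact chartFun_mem ((h.mem_chartDom hq).2 hj)

theorem contDiff_linear_insertNth (𝕜 : Type) [RCLike 𝕜] [NormedAlgebra 𝕜 ℂ]
    (Λ : (Fin 4 → ℂ) →ₗ[ℂ] (Fin 4 → ℂ)) (i l : Fin 4) :
    ContDiff 𝕜 ω fun q : C3 => Λ (i.insertNth 1 q) l := by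
  have h : (fun q : C3 => Λ (i.insertNth 1 q) l) =
      fun q => ∑ m, (i.insertNth 1 q : Fin 4 → ℂ) m * Λ (Pi.single m 1) l := by
    ext1 q
    conv_lhs => rw [← Finset.univ_sum_single (i.insertNth 1 q : Fin 4 → ℂ), map_sum,
      Finset.sum_apply]
    refine Finset.sum_congr rfl fun m _ => ?_
    rw [← smul_eq_mul, ← Pi.smul_apply, ← map_smul, ← Pi.single_smul, smul_eq_mul, mul_one]
  rw [h]
  exact ContDiff.sum fun m _ => (contDiff_insertNth 𝕜 i m).mul contDiff_const

theorem contDiffAt_chartMap (𝕜 : Type) [RCLike 𝕜] [NormedAlgebra 𝕜 ℂ] {i j : Fin 4} {q : C3}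
    (hj : Λ (i.insertNth 1 q) j ≠ 0) : ContDiffAt 𝕜 ω (chartMap Λ i j) q := by
  refine contDiffAt_pi.2 fun k => ?_
  simp only [chartMap, div_eq_mul_inv]
  exact (contDiff_linear_insertNth 𝕜 Λ i _).contDiffAt.mul
    ((contDiff_linear_insertNth 𝕜 Λ i j).contDiffAt.inv hj)

theorem chart_mem_maximalAtlas (𝕜 : Type) [RCLike 𝕜] [NormedAlgebra 𝕜 ℂ] (i : Fin 4) :
    chart i ∈ IsManifold.maximalAtlas 𝓘(𝕜, C3) ω Rat1 :=
  haveI := isManifold 𝕜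
  IsManifold.subset_maximalAtlas ⟨i, rfl⟩

/-- A map given on coefficients by a complex linear map is analytic. -/
theorem Induces.contMDiff (𝕜 : Type) [RCLike 𝕜] [NormedAlgebra 𝕜 ℂ] (h : Induces Λ f) :
    ContMDiff 𝓘(𝕜, C3) 𝓘(𝕜, C3) ω f := by
  intro p
  obtain ⟨i, hi⟩ := exists_mem_chart p
  obtain ⟨j, hj⟩ := exists_mem_chart (f p)
  replace hi : p ∈ chartDom i := hi
  have hq := chartFun_mem hi
  have hj' : Λ (i.insertNth 1 (chartFun i p)) j ≠ 0 := by
    rw [← h.mem_chartDom hq, chartInv_chartFun hi]; exact hj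
  have h1 : ContMDiffAt 𝓘(𝕜, C3) 𝓘(𝕜, C3) ω (chart i) p :=
    contMDiffAt_of_mem_maximalAtlas (chart_mem_maximalAtlas 𝕜 i) hi
  have h2 : ContMDiffAt 𝓘(𝕜, C3) 𝓘(𝕜, C3) ω (chartMap Λ i j) (chart i p) :=
    (contDiffAt_chartMap 𝕜 hj').contMDiffAt
  have h3 : ContMDiffAt 𝓘(𝕜, C3) 𝓘(𝕜, C3) ω (chart j).symm (chartMap Λ i j (chart i p)) :=
    contMDiffAt_symm_of_mem_maximalAtlas (chart_mem_maximalAtlas 𝕜 j) (h.chartMap_mem hq hj')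
  refine (h3.comp p (h2.comp p h1)).congr_of_eventuallyEq ?_
  have hne : ∀ᶠ p' in nhds p, Λ (i.insertNth 1 (chartFun i p')) j ≠ 0 := by
    have hc := (contDiff_linear_insertNth ℂ Λ i j).continuous.continuousAt.comp
      ((continuousOn_chartFun i).continuousAt ((isOpen_chartDom i).mem_nhds hi))
    exact hc.eventually_ne hj'
  filter_upwards [hne, (isOpen_chartDom i).mem_nhds hi] with p' hp' hd
  exact (congrArg f (chartInv_chartFun hd)).symm.trans
    (h.chartInv_chartMap (chartFun_mem hd) hp').symm

end

/-! ### The metric in a chart -/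

/-- A complex differentiable map has the same derivative over `ℝ`. -/
theorem exists_hasMFDerivAt_restrictScalars {M N : Type} [TopologicalSpace M] [ChartedSpace C3 M]
    [TopologicalSpace N] [ChartedSpace C3 N] {f : M → N} {x : M}
    (hf : MDifferentiableAt 𝓘(ℂ, C3) 𝓘(ℂ, C3) f x) :
    ∃ f' : C3 →L[ℂ] C3, HasMFDerivAt 𝓘(ℝ, C3) 𝓘(ℝ, C3) f x (f'.restrictScalars ℝ) := by
  have h := hf.hasMFDerivAt
  set f' : C3 →L[ℂ] C3 := mfderiv 𝓘(ℂ, C3) 𝓘(ℂ, C3) f x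
  exact ⟨f', h.1, HasFDerivWithinAt.restrictScalars (f' := f') ℝ h.2⟩

/-- The derivative of the inverse of the `i`-th chart. -/
def chartDeriv (i : Fin 4) (y : C3) : C3 →L[ℝ] C3 :=
  mfderiv 𝓘(ℝ, C3) 𝓘(ℝ, C3) (chart i).symm y

/-- The scalar product on the tangent space at `p`, as a bilinear form on `ℂ³`. -/
def innerAt (g : Metric) (p : Rat1) : C3 →L[ℝ] C3 →L[ℝ] ℝ := g.inner p

/-- The coefficients of the metric in the `i`-th chart. -/
def chartMetric (g : Metric) (i : Fin 4) (y : C3) : C3 →L[ℝ] C3 →L[ℝ] ℝ :=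
  (innerAt g (chartInv i y)).bilinearComp (chartDeriv i y) (chartDeriv i y)

theorem chartMetric_apply (g : Metric) (i : Fin 4) (y u v : C3) :
    chartMetric g i y u v = innerAt g (chartInv i y) (chartDeriv i y u) (chartDeriv i y v) := rfl

theorem chartDeriv_smul_I {i : Fin 4} {y : C3} (hy : y ∈ chartRange i) (u : C3) :
    chartDeriv i y (Complex.I • u) = Complex.I • chartDeriv i y u := by
  have h : ContMDiffAt 𝓘(ℂ, C3) 𝓘(ℂ, C3) ω (chart i).symm y :=
    contMDiffAt_symm_of_mem_maximalAtlas (chart_mem_maximalAtlas ℂ i) hy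
  obtain ⟨f', hf'⟩ := exists_hasMFDerivAt_restrictScalars (h.mdifferentiableAt (by simp))
  rw [chartDeriv, hf'.mfderiv]
  exact f'.map_smul Complex.I u

theorem formInChart_eq (g : Metric) {i : Fin 4} {y : C3} (hy : y ∈ chartRange i) (u v : C3) :
    formInChart g (chart i) y u v = chartMetric g i y (Complex.I • u) v := by
  rw [chartMetric_apply, chartDeriv_smul_I hy]
  rfl

theorem chartMetric_symm (g : Metric) (i : Fin 4) (y u v : C3) :
    chartMetric g i y u v = chartMetric g i y v u :=
  g.symm _ _ _

theorem chartMetric_smul_I {g : Metric} (hg : IsKaehler g) {i : Fin 4} {y : C3}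
    (hy : y ∈ chartRange i) (u v : C3) :
    chartMetric g i y (Complex.I • u) (Complex.I • v) = chartMetric g i y u v := by
  rw [chartMetric_apply, chartDeriv_smul_I hy, chartDeriv_smul_I hy]
  exact hg.hermitian _ _ _

/-- The smoothness of the metric, a section of a bundle, as a statement on its coefficients. -/
theorem contDiffOn_chartMetric (g : Metric) (i : Fin 4) :
    ContDiffOn ℝ 1 (chartMetric g i) (chartRange i) := by
  refine contDiffOn_clm_apply.2 fun u => contDiffOn_clm_apply.2 fun v => ?_
  have hs : ContMDiffOn 𝓘(ℝ, C3) 𝓘(ℝ, C3) 2 (chart i).symm (chartRange i) :=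
    (contMDiffOn_symm_of_mem_maximalAtlas (chart_mem_maximalAtlas ℝ i)).of_le (by simp)
  have hT := hs.contMDiffOn_tangentMapWithin (m := 1) (by norm_num)
    (isOpen_chartRange i).uniqueMDiffOn
  have hD : ∀ w : C3, ContMDiffOn 𝓘(ℝ, C3) (𝓘(ℝ, C3).prod 𝓘(ℝ, C3)) 1
      (fun y => Bundle.TotalSpace.mk' C3 (E := (TangentSpace 𝓘(ℝ, C3) : Rat1 → Type))
        ((chart i).symm y) (chartDeriv i y w)) (chartRange i) := fun w => by
    have hc : ContMDiffOn 𝓘(ℝ, C3) (𝓘(ℝ, C3).prod 𝓘(ℝ, C3)) 1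
        (fun y => (⟨y, w⟩ : TangentBundle 𝓘(ℝ, C3) C3)) (chartRange i) := fun y _ =>
      contMDiffWithinAt_vectorSpace_iff_contDiffWithinAt.2 contDiffWithinAt_const
    refine (hT.comp hc fun y hy => hy).congr fun y hy => ?_
    simp only [Function.comp_apply, tangentMapWithin,
      mfderivWithin_of_isOpen (isOpen_chartRange i) hy]
    rfl
  have hg : ContMDiffOn 𝓘(ℝ, C3) (𝓘(ℝ, C3).prod 𝓘(ℝ, C3 →L[ℝ] C3 →L[ℝ] ℝ)) 1
      (fun y => Bundle.TotalSpace.mk' (C3 →L[ℝ] C3 →L[ℝ] ℝ)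
        (E := fun p : Rat1 => TangentSpace 𝓘(ℝ, C3) p →L[ℝ] TangentSpace 𝓘(ℝ, C3) p →L[ℝ] ℝ)
        ((chart i).symm y) (g.inner ((chart i).symm y))) (chartRange i) :=
    (g.contMDiff.of_le (by norm_num)).comp_contMDiffOn (hs.of_le (by norm_num))
  have key : ContMDiffOn 𝓘(ℝ, C3) (𝓘(ℝ, C3).prod 𝓘(ℝ, ℝ)) 1
      (fun y => Bundle.TotalSpace.mk' ℝ (E := Bundle.Trivial Rat1 ℝ) ((chart i).symm y)
        (chartMetric g i y u v)) (chartRange i) :=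
    ContMDiffOn.clm_bundle_apply₂ (F₁ := C3) (F₂ := C3) hg (hD u) (hD v)
  intro y hy
  have h := key y hy
  simp only [Bundle.contMDiffWithinAt_totalSpace] at h
  exact h.2.contDiffWithinAt

/-- `f` preserves the scalar product of tangent vectors at `p`. -/
def PreservesMetricAt (g : Metric) (f : Rat1 → Rat1) (p : Rat1) : Prop :=
  ∀ u v : C3, innerAt g (f p) (mfderiv 𝓘(ℝ, C3) 𝓘(ℝ, C3) f p u)
    (mfderiv 𝓘(ℝ, C3) 𝓘(ℝ, C3) f p v) = innerAt g p u v

theorem PreservesMetricAt.comp {g : Metric} {f h : Rat1 → Rat1} {p : Rat1}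
    (hh : PreservesMetricAt g h (f p)) (hf : PreservesMetricAt g f p)
    (dh : MDifferentiableAt 𝓘(ℝ, C3) 𝓘(ℝ, C3) h (f p))
    (df : MDifferentiableAt 𝓘(ℝ, C3) 𝓘(ℝ, C3) f p) : PreservesMetricAt g (h ∘ f) p := by
  intro u v
  rw [mfderiv_comp p dh df, ← hf u v]
  exact hh _ _

theorem chartDeriv_surjective {i : Fin 4} {y : C3} (hy : y ∈ chartRange i) :
    Function.Surjective (chartDeriv i y) := by
  have h : (chart i).symm.MDifferentiable 𝓘(ℝ, C3) 𝓘(ℝ, C3) :=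
    (mdifferentiable_of_mem_atlas (Set.mem_range_self i)).symm
  exact h.mfderiv_surjective hy

/-- Preservation of the metric by a map induced by `Λ`, in the coordinates of the `i`-th chart. -/
theorem Induces.preservesMetricAt_iff {Λ : (Fin 4 → ℂ) →ₗ[ℂ] (Fin 4 → ℂ)} {f : Rat1 → Rat1}
    (h : Induces Λ f) (g : Metric) {i : Fin 4} {y : C3} (hy : y ∈ chartRange i)
    (hi : Λ (i.insertNth 1 y) i ≠ 0) {φ' : C3 →L[ℝ] C3}
    (hφ : HasFDerivAt (chartMap Λ i i) φ' y) :
    PreservesMetricAt g f (chartInv i y) ↔ ∀ u v,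
      chartMetric g i (chartMap Λ i i y) (φ' u) (φ' v) = chartMetric g i y u v := by
  have hsymm : ∀ z ∈ chartRange i, MDifferentiableAt 𝓘(ℝ, C3) 𝓘(ℝ, C3) (chart i).symm z :=
    fun z hz => (contMDiffAt_symm_of_mem_maximalAtlas (n := ω)
      (chart_mem_maximalAtlas ℝ i) hz).mdifferentiableAt (by simp)
  have hf : MDifferentiableAt 𝓘(ℝ, C3) 𝓘(ℝ, C3) f ((chart i).symm y) :=
    ((h.contMDiff ℝ) _).mdifferentiableAt (by simp)
  have heq : f ∘ (chart i).symm =ᶠ[nhds y] (chart i).symm ∘ chartMap Λ i i := by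
    filter_upwards [(isOpen_chartRange i).mem_nhds hy,
      (contDiff_linear_insertNth ℂ Λ i i).continuous.continuousAt.eventually_ne hi] with z hz hz'
    exact (h.chartInv_chartMap hz hz').symm
  have hD := heq.mfderiv_eq (I := 𝓘(ℝ, C3)) (I' := 𝓘(ℝ, C3))
  rw [mfderiv_comp y hf (hsymm y hy),
    mfderiv_comp y (hsymm _ (h.chartMap_mem hy hi)) hφ.hasMFDerivAt.mdifferentiableAt,
    hφ.hasMFDerivAt.mfderiv] at hD
  have hD' : ∀ u : C3, (mfderiv 𝓘(ℝ, C3) 𝓘(ℝ, C3) f (chartInv i y) (chartDeriv i y u) : C3) =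
      chartDeriv i (chartMap Λ i i y) (φ' u) := fun u => congrArg (fun F : C3 →L[ℝ] C3 => F u) hD
  have hpt : chartInv i (chartMap Λ i i y) = f (chartInv i y) := h.chartInv_chartMap hy hi
  rw [PreservesMetricAt, (chartDeriv_surjective hy).forall₂]
  refine forall₂_congr fun u v => ?_
  rw [chartMetric_apply, chartMetric_apply, hpt, ← hD', ← hD']

/-! ### Infinitesimal isometries in a chart -/

theorem insertNth_add' (i : Fin 4) (a b : ℂ) (u v : C3) :
    (i.insertNth (a + b) (u + v) : Fin 4 → ℂ) = i.insertNth a u + i.insertNth b v := by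
  ext m
  rcases Fin.eq_self_or_eq_succAbove i m with rfl | ⟨k, rfl⟩ <;> simp

theorem insertNth_zero_smul (i : Fin 4) (c : ℂ) (u : C3) :
    (i.insertNth 0 (c • u) : Fin 4 → ℂ) = c • i.insertNth 0 u := by
  ext m
  rcases Fin.eq_self_or_eq_succAbove i m with rfl | ⟨k, rfl⟩ <;> simp

theorem exists_hasFDerivAt_linear_insertNth (Λ : (Fin 4 → ℂ) →ₗ[ℂ] (Fin 4 → ℂ)) (i l : Fin 4)
    (q : C3) :
    ∃ D : C3 →L[ℂ] ℂ, HasFDerivAt (fun q : C3 => Λ (i.insertNth 1 q) l) D q ∧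
      ∀ u, D u = Λ (i.insertNth 0 u) l := by
  let D : C3 →ₗ[ℂ] ℂ :=
    { toFun := fun u => Λ (i.insertNth 0 u) l
      map_add' := fun u v => by
        have h := insertNth_add' i 0 0 u v
        rw [add_zero] at h
        rw [h, map_add, Pi.add_apply]
      map_smul' := fun c u => by
        rw [insertNth_zero_smul, map_smul, Pi.smul_apply, RingHom.id_apply] }
  refine ⟨D.toContinuousLinearMap, ?_, fun u => rfl⟩
  have h : (fun q : C3 => Λ (i.insertNth 1 q) l) =
      fun q => Λ (i.insertNth 1 0) l + D.toContinuousLinearMap q := by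
    ext1 q
    have h := insertNth_add' i 1 0 0 q
    rw [add_zero, zero_add] at h
    rw [h, map_add, Pi.add_apply]
    rfl
  rw [h]
  exact D.toContinuousLinearMap.hasFDerivAt.const_add _

/-- The derivative of a quotient of affine functions. -/
theorem exists_hasFDerivAt_chartMap {Λ : (Fin 4 → ℂ) →ₗ[ℂ] (Fin 4 → ℂ)} {i : Fin 4} {q : C3}
    (hi : Λ (i.insertNth 1 q) i ≠ 0) :
    ∃ φ' : C3 →L[ℝ] C3, HasFDerivAt (chartMap Λ i i) φ' q ∧ ∀ u, φ' u = fun k =>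
      (Λ (i.insertNth 0 u) (i.succAbove k) * Λ (i.insertNth 1 q) i -
        Λ (i.insertNth 1 q) (i.succAbove k) * Λ (i.insertNth 0 u) i) /
          Λ (i.insertNth 1 q) i ^ 2 := by
  choose D hD hDu using fun l => exists_hasFDerivAt_linear_insertNth Λ i l q
  have h := fun k => (hD (i.succAbove k)).mul
    ((hasDerivAt_inv hi).comp_hasFDerivAt q (hD i))
  refine ⟨(ContinuousLinearMap.pi _).restrictScalars ℝ,
    (hasFDerivAt_pi.2 h).restrictScalars ℝ, fun u => ?_⟩
  ext k
  simp [hDu]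
  field_simp
  ring

/-- The velocity at `q` of a family of maps `Λ r` of the coefficients, with `Λ 0 = 1` and with
derivative `Λ'` at `r = 0`, read in the `i`-th chart. -/
def chartField (Λ' : (Fin 4 → ℂ) →ₗ[ℂ] (Fin 4 → ℂ)) (i : Fin 4) (q : C3) : C3 := fun k =>
  Λ' (i.insertNth 1 q) (i.succAbove k) - q k * Λ' (i.insertNth 1 q) i

/-- The derivative at `q` of the vector field `chartField Λ' i` in the direction `u`. -/
def chartFieldDeriv (Λ' : (Fin 4 → ℂ) →ₗ[ℂ] (Fin 4 → ℂ)) (i : Fin 4) (q u : C3) : C3 := fun k =>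
  Λ' (i.insertNth 0 u) (i.succAbove k) - u k * Λ' (i.insertNth 1 q) i -
    q k * Λ' (i.insertNth 0 u) i

/-- The product rule for a varying bilinear form along a curve, applied to two vectors along it. -/
theorem hasDerivAt_bilin {E : Type*} [NormedAddCommGroup E] [NormedSpace ℝ E]
    {W : E → E →L[ℝ] E →L[ℝ] ℝ} {W' : E →L[ℝ] E →L[ℝ] E →L[ℝ] ℝ}
    {c a b : ℝ → E} {c' a' b' : E} {t : ℝ} (hW : HasFDerivAt W W' (c t))
    (hc : HasDerivAt c c' t) (ha : HasDerivAt a a' t) (hb : HasDerivAt b b' t) :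
    HasDerivAt (fun r => W (c r) (a r) (b r))
      (W' c' (a t) (b t) + W (c t) a' (b t) + W (c t) (a t) b') t := by
  have h1 : HasDerivAt (fun r => W (c r)) (W' c') t :=
    HasFDerivAt.comp_hasDerivAt (F := E) (E := E →L[ℝ] E →L[ℝ] ℝ) t hW hc
  simpa using (h1.clm_apply ha).clm_apply hb

section
variable {Λ : ℝ → (Fin 4 → ℂ) →ₗ[ℂ] (Fin 4 → ℂ)} {Λ' : (Fin 4 → ℂ) →ₗ[ℂ] (Fin 4 → ℂ)}

theorem hasDerivAt_chartMap (h0 : Λ 0 = LinearMap.id)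
    (hΛ : ∀ a k, HasDerivAt (fun r => Λ r a k) (Λ' a k) 0) (i : Fin 4) (q : C3) :
    HasDerivAt (fun r => chartMap (Λ r) i i q) (chartField Λ' i q) 0 := by
  refine hasDerivAt_pi.2 fun k => ?_
  have h := (hΛ (i.insertNth 1 q) (i.succAbove k)).fun_div (hΛ (i.insertNth 1 q) i) (by simp [h0])
  simpa [h0, chartField, chartMap] using h

/-- The derivative in `r` of the differential of `chartMap (Λ r) i i` at `q`, which is given by the
formula of `exists_hasFDerivAt_chartMap`, applied to `u`. -/
theorem hasDerivAt_chartMap_deriv (h0 : Λ 0 = LinearMap.id)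
    (hΛ : ∀ a k, HasDerivAt (fun r => Λ r a k) (Λ' a k) 0) (i : Fin 4) (q u : C3) :
    HasDerivAt (fun r => (fun k =>
      (Λ r (i.insertNth 0 u) (i.succAbove k) * Λ r (i.insertNth 1 q) i -
        Λ r (i.insertNth 1 q) (i.succAbove k) * Λ r (i.insertNth 0 u) i) /
          Λ r (i.insertNth 1 q) i ^ 2 : C3)) (chartFieldDeriv Λ' i q u) 0 := by
  refine hasDerivAt_pi.2 fun k => ?_
  have h := (((hΛ (i.insertNth 0 u) (i.succAbove k)).fun_mul (hΛ (i.insertNth 1 q) i)).fun_sub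
    ((hΛ (i.insertNth 1 q) (i.succAbove k)).fun_mul (hΛ (i.insertNth 0 u) i))).fun_div
    ((hΛ (i.insertNth 1 q) i).fun_pow 2) (by simp [h0])
  refine h.congr_deriv ?_
  simp [h0, chartFieldDeriv]
  ring

/-- The Killing equation: the Lie derivative of the metric along the velocity field of a family of
isometries vanishes. -/
theorem killing {g : Metric} {f : ℝ → Rat1 → Rat1} (hf : ∀ r, Induces (Λ r) (f r))
    (hg : ∀ r p, PreservesMetricAt g (f r) p) (h0 : Λ 0 = LinearMap.id)
    (hΛ : ∀ a k, HasDerivAt (fun r => Λ r a k) (Λ' a k) 0) {i : Fin 4} {q : C3}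
    (hq : q ∈ chartRange i) (u v : C3) :
    fderiv ℝ (chartMetric g i) q (chartField Λ' i q) u v +
      chartMetric g i q (chartFieldDeriv Λ' i q u) v +
      chartMetric g i q u (chartFieldDeriv Λ' i q v) = 0 := by
  have hW : HasFDerivAt (chartMetric g i) (fderiv ℝ (chartMetric g i) q) q :=
    (((contDiffOn_chartMetric g i).contDiffAt
      ((isOpen_chartRange i).mem_nhds hq)).differentiableAt (by simp)).hasFDerivAt
  have hc0 : chartMap (Λ 0) i i q = q := by ext k; simp [h0, chartMap]
  have hw0 : ∀ w : C3, (fun k => (Λ 0 (i.insertNth 0 w) (i.succAbove k) * Λ 0 (i.insertNth 1 q) i -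
        Λ 0 (i.insertNth 1 q) (i.succAbove k) * Λ 0 (i.insertNth 0 w) i) /
          Λ 0 (i.insertNth 1 q) i ^ 2 : C3) = w := fun w => by ext k; simp [h0]
  have h := hasDerivAt_bilin (W := chartMetric g i) (by rw [hc0]; exact hW)
    (hasDerivAt_chartMap h0 hΛ i q) (hasDerivAt_chartMap_deriv h0 hΛ i q u)
    (hasDerivAt_chartMap_deriv h0 hΛ i q v)
  simp only [hc0, hw0] at h
  refine h.unique ((hasDerivAt_const 0 (chartMetric g i q u v)).congr_of_eventuallyEq ?_)
  have hne : ∀ᶠ r in nhds (0 : ℝ), Λ r (i.insertNth 1 q) i ≠ 0 :=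
    (hΛ (i.insertNth 1 q) i).continuousAt.eventually_ne (by simp [h0])
  filter_upwards [hne] with r hr
  obtain ⟨φ', hφ, hφu⟩ := exists_hasFDerivAt_chartMap hr
  rw [← hφu, ← hφu]
  exact ((hf r).preservesMetricAt_iff g hq hr hφ).1 (hg r _) u v

end

/-- The Kähler form is antisymmetric. -/
theorem chartMetric_form_antisymm {g : Metric} (hK : IsKaehler g) {i : Fin 4} {q : C3}
    (hq : q ∈ chartRange i) (u v : C3) :
    chartMetric g i q (Complex.I • u) v = -chartMetric g i q (Complex.I • v) u := by
  rw [chartMetric_symm g i q (Complex.I • v) u, ← chartMetric_smul_I hK hq u (Complex.I • v),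
    smul_smul, Complex.I_mul_I, neg_one_smul, map_neg, neg_neg]

/-- The closedness of the Kähler form as an identity between derivatives of the metric. -/
theorem chartMetric_closed {g : Metric} (hK : IsKaehler g) {i : Fin 4} {q : C3}
    (hq : q ∈ chartRange i) (u v w : C3) :
    fderiv ℝ (chartMetric g i) q u (Complex.I • v) w +
      fderiv ℝ (chartMetric g i) q v (Complex.I • w) u +
      fderiv ℝ (chartMetric g i) q w (Complex.I • u) v = 0 := by
  have hW : HasFDerivAt (chartMetric g i) (fderiv ℝ (chartMetric g i) q) q :=
    (((contDiffOn_chartMetric g i).contDiffAt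
      ((isOpen_chartRange i).mem_nhds hq)).differentiableAt (by simp)).hasFDerivAt
  have key : ∀ a b c : C3, fderiv ℝ (fun x => formInChart g (chart i) x a b) q c =
      fderiv ℝ (chartMetric g i) q c (Complex.I • a) b := fun a b c => by
    have heq : (fun x => formInChart g (chart i) x a b) =ᶠ[nhds q]
        fun x => chartMetric g i x (Complex.I • a) b := by
      filter_upwards [(isOpen_chartRange i).mem_nhds hq] with x hx
      exact formInChart_eq g hx a b
    have h := (hW.clm_apply (hasFDerivAt_const (Complex.I • a) q)).clm_apply (hasFDerivAt_const b q)
    rw [heq.fderiv_eq, h.fderiv]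
    simp
  have h := hK.closed (chart i) ⟨i, rfl⟩ q hq u v w
  simpa only [key] using h

/-! ### The unitary action, inversion and transposition -/

/-- The map `L ↦ A L B` of coefficient vectors. -/
def sandwich (A B : Matrix (Fin 2) (Fin 2) ℂ) : (Fin 4 → ℂ) →ₗ[ℂ] (Fin 4 → ℂ) where
  toFun a := coeffs (A * ofCoeffs a * B)
  map_add' a b := by
    have h : ofCoeffs (a + b) = ofCoeffs a + ofCoeffs b := by
      ext i j; fin_cases i <;> fin_cases j <;> rfl
    rw [h, mul_add, add_mul]
    ext i; fin_cases i <;> rfl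
  map_smul' c a := by
    rw [ofCoeffs_smul, Matrix.mul_smul, Matrix.smul_mul, coeffs_smul, RingHom.id_apply]

theorem sandwich_apply (A B : Matrix (Fin 2) (Fin 2) ℂ) (a : Fin 4 → ℂ) :
    sandwich A B a = coeffs (A * ofCoeffs a * B) := rfl

theorem induces_act (U V : Matrix.unitaryGroup (Fin 2) ℂ) :
    Induces (sandwich U.1 V.1ᴴ) (act U V) := by
  intro L
  refine ⟨Unitary.toUnits U * L * (Unitary.toUnits V)⁻¹, ?_, ?_⟩
  · simp only [act, map_mul, map_inv]
  · rw [sandwich_apply, ofCoeffs_coeffs]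
    rfl

/-- The adjugate as a map of coefficient vectors. -/
def adjCoeffs : (Fin 4 → ℂ) →ₗ[ℂ] (Fin 4 → ℂ) where
  toFun a := ![a 3, -a 1, -a 2, a 0]
  map_add' a b := by ext i; fin_cases i <;> simp <;> ring
  map_smul' c a := by ext i; fin_cases i <;> simp

theorem adjCoeffs_coeffs (L : Matrix (Fin 2) (Fin 2) ℂ) :
    adjCoeffs (coeffs L) = coeffs L.adjugate := by
  rw [Matrix.adjugate_fin_two]
  ext i; fin_cases i <;> simp [adjCoeffs, coeffs]

theorem induces_inv : Induces adjCoeffs fun p => p⁻¹ := by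
  intro L
  have hL : L.1.det ≠ 0 := (L.1.isUnit_iff_isUnit_det.1 L.isUnit).ne_zero
  have hd : L.1.adjugate.det ≠ 0 := by
    rw [Matrix.det_adjugate]
    exact pow_ne_zero _ hL
  refine ⟨Matrix.GeneralLinearGroup.mkOfDetNeZero L.1.adjugate hd, ?_, (adjCoeffs_coeffs _).symm⟩
  change (cls L)⁻¹ = _
  rw [← map_inv]
  refine cls_eq_cls.2 ⟨L.1.det, hL, ?_⟩
  change L.1.adjugate = L.1.det • (L⁻¹ : GL (Fin 2) ℂ).1
  rw [Matrix.coe_units_inv, Matrix.inv_def, Ring.inverse_eq_inv', smul_smul, mul_inv_cancel₀ hL,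
    one_smul]

theorem Induces.comp {Λ Λ' : (Fin 4 → ℂ) →ₗ[ℂ] (Fin 4 → ℂ)} {f f' : Rat1 → Rat1}
    (h : Induces Λ f) (h' : Induces Λ' f') : Induces (Λ ∘ₗ Λ') (f ∘ f') := by
  intro L
  obtain ⟨M, hM, hc⟩ := h' L
  obtain ⟨N, hN, hc'⟩ := h M
  exact ⟨N, by rw [Function.comp_apply, hM, hN], by rw [hc', hc]; rfl⟩

theorem Induces.mdifferentiableAt {Λ : (Fin 4 → ℂ) →ₗ[ℂ] (Fin 4 → ℂ)} {f : Rat1 → Rat1}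
    (h : Induces Λ f) (p : Rat1) : MDifferentiableAt 𝓘(ℝ, C3) 𝓘(ℝ, C3) f p :=
  ((h.contMDiff ℝ) p).mdifferentiableAt (by simp)

/-- The rotation `!![0, 1; -1, 0]`, which conjugates the adjugate of a matrix to its transpose. -/
def weyl : Matrix.unitaryGroup (Fin 2) ℂ :=
  ⟨!![0, 1; -1, 0], by
    rw [Matrix.mem_unitaryGroup_iff']
    ext i j; fin_cases i <;> fin_cases j <;>
      simp [Matrix.mul_apply, Fin.sum_univ_two, Matrix.star_apply]⟩

theorem sandwich_weyl_adjCoeffs (a : Fin 4 → ℂ) :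
    (sandwich weyl.1 weyl.1ᴴ ∘ₗ adjCoeffs) a = ![a 0, a 2, a 1, a 3] := by
  ext i
  fin_cases i <;>
    simp [sandwich_apply, adjCoeffs, weyl, coeffs, ofCoeffs, Matrix.mul_apply, Fin.sum_univ_two]

theorem weyl_act_act (p : Rat1) : act weyl⁻¹ weyl⁻¹ (act weyl weyl p) = p := by
  simp only [act, map_inv]
  group

/-- The diagonal point `diag (1, s)` in the chart `a₁ = 1`. -/
def diagPt (s : ℝ) : C3 := ![0, 0, s]

theorem insertNth_zero_eq (c : ℂ) (q : C3) :
    ((0 : Fin 4).insertNth c q : Fin 4 → ℂ) = ![c, q 0, q 1, q 2] := by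
  ext i; fin_cases i <;> rfl

theorem diagPt_mem {s : ℝ} (hs : 0 < s) : diagPt s ∈ chartRange 0 := by
  rw [mem_chartRange, insertNth_zero_eq]
  simp [ofCoeffs, diagPt, Matrix.det_fin_two, hs.ne']

/-- The decomposition of `PGL(2, ℂ)` into a unitary, a positive diagonal and a unitary factor: the
polar decomposition followed by the diagonalization of the positive factor. -/
theorem exists_act_diagPt (p : Rat1) :
    ∃ U V : Matrix.unitaryGroup (Fin 2) ℂ, ∃ s : ℝ, 0 < s ∧
      p = act U V (chartInv 0 (diagPt s)) := by
  obtain ⟨⟨R, l⟩, rfl⟩ := polarFun_surjective p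
  obtain ⟨U, rfl⟩ := Ad_surjective R
  have hH : (boost l).IsHermitian := boost_conjTranspose l
  set E := hH.eigenvalues with hE
  set V := hH.eigenvectorUnitary with hV
  have hsp : boost l = V.1 * Matrix.diagonal (fun i => (E i : ℂ)) * V.1ᴴ := by
    have h := hH.spectral_theorem
    rw [Unitary.conjStarAlgAut_apply] at h
    exact h
  have hdet : E 0 * E 1 = 1 := by
    have h := hH.det_eq_prod_eigenvalues
    rw [boost_det, Fin.prod_univ_two] at h
    refine Complex.ofReal_injective ?_
    rw [Complex.ofReal_mul, Complex.ofReal_one]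
    exact h.symm
  have h0 : E 0 ≠ 0 := left_ne_zero_of_mul_eq_one hdet
  -- The two eigenvalues have product one, so their ratio is a square.
  have hs : 0 < E 1 / E 0 := by
    have : E 1 / E 0 = E 1 ^ 2 := by
      rw [div_eq_iff h0, sq, mul_assoc, mul_comm (E 1) (E 0), hdet, mul_one]
    rw [this]
    exact sq_pos_of_ne_zero (right_ne_zero_of_mul_eq_one hdet)
  refine ⟨U * V, V, E 1 / E 0, hs, ?_⟩
  rw [polarFun_Ad, chartInv_of_mem (mem_chartRange.1 (diagPt_mem hs)), act, ← map_mul, ← map_mul,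
    ← map_inv, ← map_mul]
  refine (cls_eq_cls.2 ⟨E 0, Complex.ofReal_ne_zero.2 h0, ?_⟩).symm
  change U.1 * boost l = (E 0 : ℂ) • (U.1 * V.1 *
    ofCoeffs ((0 : Fin 4).insertNth 1 (diagPt (E 1 / E 0))) * V.1ᴴ)
  have hdiag : Matrix.diagonal (fun i => (E i : ℂ)) =
      (E 0 : ℂ) • ofCoeffs ((0 : Fin 4).insertNth 1 (diagPt (E 1 / E 0))) := by
    have h0' : (E 0 : ℂ) ≠ 0 := Complex.ofReal_ne_zero.2 h0
    rw [insertNth_zero_eq]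
    ext i j
    fin_cases i <;> fin_cases j <;> simp [ofCoeffs, diagPt]
    field_simp
  rw [hsp, hdiag]
  simp only [Matrix.mul_smul, Matrix.smul_mul, mul_assoc]

/-! ### Infinitesimal conjugation by unitary matrices -/

/-- The one-parameter group of unitary matrices generated by `!![0, β; -conj β, 0]`. -/
def rot (β : ℂ) (hβ : star β * β = 1) (r : ℝ) : Matrix.unitaryGroup (Fin 2) ℂ :=
  ⟨!![(Real.cos r : ℂ), β * Real.sin r; -star β * Real.sin r, (Real.cos r : ℂ)], by
    have h : (Real.cos r : ℂ) ^ 2 + (Real.sin r : ℂ) ^ 2 = 1 := by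
      exact_mod_cast Real.cos_sq_add_sin_sq r
    have hc : (starRingEnd ℂ) (Real.cos r : ℂ) = Real.cos r := Complex.conj_ofReal _
    have hs : (starRingEnd ℂ) (Real.sin r : ℂ) = Real.sin r := Complex.conj_ofReal _
    rw [RCLike.star_def] at *
    rw [Matrix.mem_unitaryGroup_iff']
    generalize (Real.cos r : ℂ) = c at *
    generalize (Real.sin r : ℂ) = s at *
    ext i j; fin_cases i <;> fin_cases j <;>
      simp [Matrix.mul_apply, Fin.sum_univ_two, Matrix.star_apply, hc, hs]
    · linear_combination h + s ^ 2 * hβ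
    · ring
    · ring
    · linear_combination h + s ^ 2 * hβ⟩

/-- The commutator with `!![0, β; -conj β, 0]`, as a map of coefficient vectors. -/
def commCoeffs (β : ℂ) : (Fin 4 → ℂ) →ₗ[ℂ] (Fin 4 → ℂ) where
  toFun a := ![β * a 2 + star β * a 1, β * (a 3 - a 0), star β * (a 3 - a 0),
    -(β * a 2 + star β * a 1)]
  map_add' a b := by ext i; fin_cases i <;> simp <;> ring
  map_smul' c a := by ext i; fin_cases i <;> simp <;> ring

theorem sandwich_rot_zero (β : ℂ) (hβ : star β * β = 1) :
    sandwich (rot β hβ 0).1 (rot β hβ 0).1ᴴ = LinearMap.id := by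
  have h : (rot β hβ 0).1 = 1 := by
    ext i j; fin_cases i <;> fin_cases j <;> simp [rot]
  refine LinearMap.ext fun a => ?_
  rw [sandwich_apply, h, Matrix.conjTranspose_one, one_mul, mul_one, coeffs_ofCoeffs,
    LinearMap.id_apply]

theorem hasDerivAt_cos_sin_form (p q t : ℂ) :
    HasDerivAt (fun r : ℝ => p * (Real.cos r : ℂ) ^ 2 + q * ((Real.cos r : ℂ) * Real.sin r) +
      t * (Real.sin r : ℂ) ^ 2) q 0 := by
  have hc := (Real.hasDerivAt_cos 0).ofReal_comp
  have hs := (Real.hasDerivAt_sin 0).ofReal_comp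
  refine ((((hc.fun_pow 2).const_mul p).fun_add ((hc.fun_mul hs).const_mul q)).fun_add
    ((hs.fun_pow 2).const_mul t)).congr_deriv ?_
  simp

theorem hasDerivAt_sandwich_rot (β : ℂ) (hβ : star β * β = 1) (a : Fin 4 → ℂ) (k : Fin 4) :
    HasDerivAt (fun r => sandwich (rot β hβ r).1 (rot β hβ r).1ᴴ a k) (commCoeffs β a k) 0 := by
  have key : ∀ k, ∃ p t : ℂ, ∀ r : ℝ, sandwich (rot β hβ r).1 (rot β hβ r).1ᴴ a k =
      p * (Real.cos r : ℂ) ^ 2 + commCoeffs β a k * ((Real.cos r : ℂ) * Real.sin r) +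
      t * (Real.sin r : ℂ) ^ 2 := by
    have hc : ∀ r : ℝ, (starRingEnd ℂ) (Real.cos r : ℂ) = Real.cos r :=
      fun r => Complex.conj_ofReal _
    have hs : ∀ r : ℝ, (starRingEnd ℂ) (Real.sin r : ℂ) = Real.sin r :=
      fun r => Complex.conj_ofReal _
    intro k
    refine ⟨a k, (![β * star β * a 3, -β * β * a 2, -star β * star β * a 1, β * star β * a 0] :
      Fin 4 → ℂ) k, fun r => ?_⟩
    rw [RCLike.star_def]
    have hc := hc r
    have hs := hs r
    fin_cases k <;>
      simp [sandwich_apply, rot, commCoeffs, coeffs, ofCoeffs, Matrix.mul_apply, Fin.sum_univ_two,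
        -Complex.ofReal_cos, -Complex.ofReal_sin, hc, hs] <;> ring
  -- Only the mixed term `cos r * sin r` contributes at `r = 0`.
  obtain ⟨p, t, h⟩ := key k
  simp only [h]
  exact hasDerivAt_cos_sin_form _ _ _

theorem chartField_commCoeffs (β : ℂ) (s : ℝ) :
    chartField (commCoeffs β) 0 (diagPt s) = ((s : ℂ) - 1) • ![β, star β, 0] := by
  ext k
  simp only [chartField, insertNth_zero_eq]
  fin_cases k <;> simp [commCoeffs, diagPt] <;> ring

theorem chartFieldDeriv_commCoeffs (β : ℂ) (s : ℝ) (u : C3) :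
    chartFieldDeriv (commCoeffs β) 0 (diagPt s) u =
      ![β * u 2, star β * u 2, -(1 + s) * (β * u 1 + star β * u 0)] := by
  ext k
  simp only [chartFieldDeriv, insertNth_zero_eq]
  fin_cases k <;> simp [commCoeffs, diagPt]
  ring

/-! ### The metric at diagonal points -/

/-- The tangent vector `(1, 1, 0)`, tangent at diagonal points to the conjugation orbit. -/
def orbX : C3 := ![1, 1, 0]

/-- The tangent vector `(i, -i, 0)`, tangent at diagonal points to the conjugation orbit. -/
def orbY : C3 := ![Complex.I, -Complex.I, 0]

/-- The Killing equation for the conjugation by the rotations generated by `!![0, β; -conj β, 0]`,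
at a diagonal point. -/
theorem killing_conj {g : Metric} (hG : IsInvariant g) {β : ℂ} (hβ : star β * β = 1) {s : ℝ}
    (hs : 0 < s) (u v : C3) :
    fderiv ℝ (chartMetric g 0) (diagPt s) (((s : ℂ) - 1) • ![β, star β, 0]) u v +
      chartMetric g 0 (diagPt s)
        ![β * u 2, star β * u 2, -(1 + s) * (β * u 1 + star β * u 0)] v +
      chartMetric g 0 (diagPt s) u
        ![β * v 2, star β * v 2, -(1 + s) * (β * v 1 + star β * v 0)] = 0 := by
  have h := killing (g := g) (fun r => induces_act (rot β hβ r) (rot β hβ r))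
    (fun r p => hG _ _ p) (sandwich_rot_zero β hβ) (hasDerivAt_sandwich_rot β hβ)
    (diagPt_mem hs) u v
  rwa [chartField_commCoeffs, chartFieldDeriv_commCoeffs, chartFieldDeriv_commCoeffs] at h

theorem hasDerivAt_diagPt (s : ℝ) : HasDerivAt diagPt ![0, 0, 1] s := by
  refine hasDerivAt_pi.2 fun k => ?_
  fin_cases k
  · exact hasDerivAt_const _ _
  · exact hasDerivAt_const _ _
  · exact (hasDerivAt_id s).ofReal_comp

/-- Along the diagonal the value of the Kähler form on the two conjugation fields
`(s - 1) (1, 1, 0)` and `(s - 1) (i, -i, 0)` is stationary: its differential is the contraction of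
the form with the bracket of the two fields, which vanishes at diagonal points. -/
theorem hasDerivAt_form_orbit {g : Metric} (hK : IsKaehler g) (hG : IsInvariant g) {s : ℝ}
    (hs : 0 < s) :
    HasDerivAt (fun s : ℝ => chartMetric g 0 (diagPt s) (Complex.I • (s - 1) • orbX)
      ((s - 1) • orbY)) 0 s := by
  have hq := diagPt_mem hs
  have hW : HasFDerivAt (chartMetric g 0) (fderiv ℝ (chartMetric g 0) (diagPt s)) (diagPt s) :=
    (((contDiffOn_chartMetric g 0).contDiffAt
      ((isOpen_chartRange 0).mem_nhds hq)).differentiableAt (by simp)).hasFDerivAt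
  have hlin : HasDerivAt (fun s : ℝ => s - 1) 1 s := (hasDerivAt_id s).sub_const 1
  have hX : HasDerivAt (fun s : ℝ => Complex.I • (s - 1) • orbX) (Complex.I • orbX) s := by
    simpa using (hlin.smul_const orbX).fun_const_smul Complex.I
  have hY : HasDerivAt (fun s : ℝ => (s - 1) • orbY) orbY s := by
    simpa using hlin.smul_const orbY
  refine (hasDerivAt_bilin hW (hasDerivAt_diagPt s) hX hY).congr_deriv ?_
  have hcl := chartMetric_closed hK hq ![0, 0, 1] ((s - 1) • orbX) ((s - 1) • orbY)
  have eX : (s - 1) • orbX = ((s : ℂ) - 1) • ![1, star 1, 0] := by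
    ext k; fin_cases k <;> simp [orbX]
  have eY : (s - 1) • orbY = ((s : ℂ) - 1) • ![Complex.I, star Complex.I, 0] := by
    ext k; fin_cases k <;> simp [orbY]
  have kX := killing_conj hG (β := 1) (by simp) hs (Complex.I • (s - 1) • orbY) ![0, 0, 1]
  have kY := killing_conj hG (β := Complex.I) (by simp) hs (Complex.I • ![0, 0, 1])
    ((s - 1) • orbX)
  rw [← eX] at kX
  rw [← eY] at kY
  -- `d2` and `d3` are the derivatives of the fields along the diagonal; `d1` and `d4`, their
  -- derivatives along each other, vanish because `1 * conj i` is imaginary.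
  have d1 : (![1 * (Complex.I • (s - 1) • orbY) 2, star 1 * (Complex.I • (s - 1) • orbY) 2,
      -(1 + s) * (1 * (Complex.I • (s - 1) • orbY) 1 + star 1 * (Complex.I • (s - 1) • orbY) 0)]
      : C3) = 0 := by
    ext k; fin_cases k <;> simp [orbY]
  have d2 : (![1 * (![0, 0, 1] : C3) 2, star 1 * (![0, 0, 1] : C3) 2,
      -(1 + s) * (1 * (![0, 0, 1] : C3) 1 + star 1 * (![0, 0, 1] : C3) 0)] : C3) = orbX := by
    ext k; fin_cases k <;> simp [orbX]
  have d3 : (![Complex.I * (Complex.I • (![0, 0, 1] : C3)) 2,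
      star Complex.I * (Complex.I • (![0, 0, 1] : C3)) 2,
      -(1 + s) * (Complex.I * (Complex.I • (![0, 0, 1] : C3)) 1 +
        star Complex.I * (Complex.I • (![0, 0, 1] : C3)) 0)] : C3) = Complex.I • orbY := by
    ext k; fin_cases k <;> simp [orbY]
  have d4 : (![Complex.I * ((s - 1) • orbX) 2, star Complex.I * ((s - 1) • orbX) 2,
      -(1 + s) * (Complex.I * ((s - 1) • orbX) 1 + star Complex.I * ((s - 1) • orbX) 0)] : C3)
      = 0 := by
    ext k; fin_cases k <;> simp [orbX]
  rw [d1, d2, map_zero, zero_apply] at kX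
  rw [d3, d4, map_zero] at kY
  have a1 := chartMetric_form_antisymm hK hq orbX ((s - 1) • orbY)
  have a2 := chartMetric_form_antisymm hK hq orbY ((s - 1) • orbX)
  linarith

/-- The form vanishes on `(1, 1, 0)` and `(i, -i, 0)` at diagonal points: by
`hasDerivAt_form_orbit` its product with `(s - 1) ^ 2` is constant, and the constant is zero since
the conjugation fields vanish at the identity. -/
theorem form_orbit_eq_zero {g : Metric} (hK : IsKaehler g) (hG : IsInvariant g) {s : ℝ}
    (hs : 0 < s) : chartMetric g 0 (diagPt s) (Complex.I • orbX) orbY = 0 := by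
  set k : ℝ → ℝ := fun s => chartMetric g 0 (diagPt s) (Complex.I • orbX) orbY with hk
  have hne : ∀ t : ℝ, 0 < t → t ≠ 1 → k t = 0 := by
    intro t ht ht1
    have h := isOpen_Ioi.is_const_of_deriv_eq_zero (isPreconnected_Ioi (a := (0 : ℝ)))
      (fun t ht => (hasDerivAt_form_orbit hK hG ht).differentiableAt.differentiableWithinAt)
      (fun t ht => (hasDerivAt_form_orbit hK hG ht).deriv) (Set.mem_Ioi.2 ht)
      (Set.mem_Ioi.2 one_pos)
    simp only [sub_self, zero_smul, map_zero] at h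
    rw [smul_comm, map_smul, map_smul, smul_apply, smul_smul] at h
    exact (smul_eq_zero.1 h).resolve_left (mul_self_ne_zero.2 (sub_ne_zero.2 ht1))
  rcases eq_or_ne s 1 with rfl | h1
  · have hW : ContinuousAt (chartMetric g 0) (diagPt 1) :=
      (contDiffOn_chartMetric g 0).continuousOn.continuousAt
        ((isOpen_chartRange 0).mem_nhds (diagPt_mem hs))
    have hW' : ContinuousAt (fun t : ℝ => chartMetric g 0 (diagPt t)) 1 :=
      ContinuousAt.comp (g := chartMetric g 0) (f := diagPt) hW (hasDerivAt_diagPt 1).continuousAt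
    have hkc : ContinuousAt k 1 := (hW'.clm_apply continuousAt_const).clm_apply continuousAt_const
    have hz : k =ᶠ[nhdsWithin 1 {1}ᶜ] fun _ => 0 := by
      filter_upwards [self_mem_nhdsWithin, mem_nhdsWithin_of_mem_nhds (Ioi_mem_nhds hs)] with t h h'
      exact hne t h' h
    exact tendsto_nhds_unique (hkc.tendsto.mono_left nhdsWithin_le_nhds)
      (tendsto_const_nhds.congr' hz.symm)
  · exact hne s hs h1

/-- A real bilinear form on `ℂ³` that is Hermitian and invariant under `(i, -i, 1)` is diagonal,
since the three coordinate lines carry different characters. If its first two entries agree, it is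
invariant under the exchange of the first two coordinates. -/
theorem bilin_swap {B : C3 →L[ℝ] C3 →L[ℝ] ℝ} (hsymm : ∀ u v, B u v = B v u)
    (hI : ∀ u v, B (Complex.I • u) (Complex.I • v) = B u v)
    (hρ : ∀ u v : C3, B ![Complex.I * u 0, -Complex.I * u 1, u 2]
      ![Complex.I * v 0, -Complex.I * v 1, v 2] = B u v)
    (hxy : B (Complex.I • orbX) orbY = 0) (u v : C3) :
    B ![u 1, u 0, u 2] ![v 1, v 0, v 2] = B u v := by
  have i0 : ∀ a : ℂ, Complex.I • (![a, 0, 0] : C3) = ![Complex.I * a, 0, 0] := fun a => by simp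
  have i1 : ∀ a : ℂ, Complex.I • (![0, a, 0] : C3) = ![0, Complex.I * a, 0] := fun a => by simp
  have n0 : ∀ a : ℂ, (![-a, 0, 0] : C3) = -![a, 0, 0] := fun a => by simp
  have n1 : ∀ a : ℂ, (![0, -a, 0] : C3) = -![0, a, 0] := fun a => by simp
  have hII : ∀ a : ℂ, Complex.I * (Complex.I * a) = -a := fun a => by simp [← mul_assoc]
  have hρ' : ∀ a b c a' b' c' : ℂ, B ![Complex.I * a, -Complex.I * b, c]
      ![Complex.I * a', -Complex.I * b', c'] = B ![a, b, c] ![a', b', c'] :=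
    fun a b c a' b' c' => hρ ![a, b, c] ![a', b', c']
  have h01 : ∀ a b : ℂ, B ![a, 0, 0] ![0, b, 0] = 0 := fun a b => by
    have h1 := hI ![a, 0, 0] ![0, b, 0]
    have h2 := hρ' a 0 0 0 b 0
    simp only [i0, i1] at h1
    simp only [mul_zero, neg_mul, n1, map_neg] at h2
    linarith
  have h02 : ∀ a b : ℂ, B ![a, 0, 0] ![0, 0, b] = 0 := fun a b => by
    have h1 := hρ' a 0 0 0 0 b
    have h2 := hρ' (Complex.I * a) 0 0 0 0 b
    simp only [hII, mul_zero, n0, map_neg, neg_apply] at h1 h2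
    linarith
  have h12 : ∀ a b : ℂ, B ![0, a, 0] ![0, 0, b] = 0 := fun a b => by
    have h1 := hρ' 0 a 0 0 0 b
    have h2 := hρ' 0 (Complex.I * a) 0 0 0 b
    simp only [hII, mul_zero, neg_mul, neg_neg, n1, map_neg, neg_apply] at h1 h2
    linarith
  -- On a complex line a Hermitian form is determined by the square length of one vector.
  have line : ∀ e : C3, ∀ a b : ℂ,
      B (a • e) (b • e) = (a.re * b.re + a.im * b.im) * B e e := fun e a b => by
    have hz : B e (Complex.I • e) = 0 := by
      have h1 := hI e (Complex.I • e)
      rw [smul_smul, Complex.I_mul_I, neg_one_smul, map_neg] at h1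
      have h2 := hsymm (Complex.I • e) e
      linarith
    have hz' : B (Complex.I • e) e = 0 := (hsymm _ _).trans hz
    have ex : ∀ c : ℂ, c • e = c.re • e + c.im • Complex.I • e := fun c => by
      ext k
      simp only [Pi.smul_apply, Pi.add_apply, smul_eq_mul, Complex.real_smul]
      conv_lhs => rw [← Complex.re_add_im c]
      ring
    rw [ex a, ex b]
    simp only [map_add, map_smul, add_apply, smul_apply,
      smul_eq_mul, hz, hz', hI]
    ring
  have s0 : ∀ a : ℂ, (![a, 0, 0] : C3) = a • ![1, 0, 0] := fun a => by simp
  have s1 : ∀ a : ℂ, (![0, a, 0] : C3) = a • ![0, 1, 0] := fun a => by simp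
  have split : ∀ a b c : ℂ, (![a, b, c] : C3) = ![a, 0, 0] + ![0, b, 0] + ![0, 0, c] :=
    fun a b c => by simp
  have expand : ∀ a b c a' b' c' : ℂ, B ![a, b, c] ![a', b', c'] =
      (a.re * a'.re + a.im * a'.im) * B ![1, 0, 0] ![1, 0, 0] +
      (b.re * b'.re + b.im * b'.im) * B ![0, 1, 0] ![0, 1, 0] + B ![0, 0, c] ![0, 0, c'] := by
    intro a b c a' b' c'
    rw [split a b c, split a' b' c']
    simp only [map_add, add_apply, h01, h02, h12, hsymm ![0, _, 0] ![_, 0, 0],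
      hsymm ![0, 0, _] ![_, 0, 0], hsymm ![0, 0, _] ![0, _, 0]]
    rw [s0 a, s0 a', s1 b, s1 b', line, line]
    ring
  have hxy' : B ![1, 0, 0] ![1, 0, 0] = B ![0, 1, 0] ![0, 1, 0] := by
    have e : Complex.I • orbX = ![Complex.I, Complex.I, 0] := by simp [orbX]
    rw [e, orbY, expand] at hxy
    have hz : B ![0, 0, 0] ![0, 0, 0] = 0 := by
      have : (![0, 0, 0] : C3) = 0 := by simp
      rw [this, map_zero]
    simp [hz] at hxy
    linarith
  have eta : ∀ w : C3, w = ![w 0, w 1, w 2] := fun w => by ext k; fin_cases k <;> rfl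
  have h := expand (u 0) (u 1) (u 2) (v 0) (v 1) (v 2)
  rw [← eta u, ← eta v] at h
  rw [expand, h, hxy']
  ring

/-- The unitary matrix `diag (i, 1)`. -/
def diagI : Matrix.unitaryGroup (Fin 2) ℂ :=
  ⟨!![Complex.I, 0; 0, 1], by
    rw [Matrix.mem_unitaryGroup_iff']
    ext i j; fin_cases i <;> fin_cases j <;>
      simp [Matrix.mul_apply, Fin.sum_univ_two, Matrix.star_apply]⟩

/-- The transposition, composed of inversion and of a conjugation, preserves the metric at diagonal
points. -/
theorem preservesMetricAt_transpose {g : Metric} (hK : IsKaehler g) (hG : IsInvariant g) {s : ℝ}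
    (hs : 0 < s) :
    PreservesMetricAt g (act weyl weyl ∘ fun p => p⁻¹) (chartInv 0 (diagPt s)) := by
  have hq := diagPt_mem hs
  have hI := induces_act diagI diagI
  have hIc : ∀ a, sandwich diagI.1 diagI.1ᴴ a =
      ![a 0, Complex.I * a 1, -Complex.I * a 2, a 3] := fun a => by
    ext i
    fin_cases i <;> simp [sandwich_apply, diagI, coeffs, ofCoeffs, Matrix.mul_apply,
      Fin.sum_univ_two] <;> first | ring1 | linear_combination (-a 0) * Complex.I_sq
  have hIn : sandwich diagI.1 diagI.1ᴴ ((0 : Fin 4).insertNth 1 (diagPt s)) 0 ≠ 0 := by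
    rw [hIc]; simp
  obtain ⟨φ, hφ, hφu⟩ := exists_hasFDerivAt_chartMap hIn
  have h1 := (hI.preservesMetricAt_iff g hq hIn hφ).1 (hG _ _ _)
  have hT := (induces_act weyl weyl).comp induces_inv
  have hTn : (sandwich weyl.1 weyl.1ᴴ ∘ₗ adjCoeffs)
      ((0 : Fin 4).insertNth 1 (diagPt s)) 0 ≠ 0 := by
    rw [sandwich_weyl_adjCoeffs]; simp
  obtain ⟨ψ, hψ, hψu⟩ := exists_hasFDerivAt_chartMap hTn
  refine (hT.preservesMetricAt_iff g hq hTn hψ).2 ?_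
  have eI : chartMap (sandwich diagI.1 diagI.1ᴴ) 0 0 (diagPt s) = diagPt s := by
    ext k
    simp only [chartMap, hIc, insertNth_zero_eq]
    fin_cases k <;> simp [diagPt]
  have eφ : ∀ u : C3, φ u = ![Complex.I * u 0, -Complex.I * u 1, u 2] := fun u => by
    rw [hφu]
    ext k
    simp only [hIc, insertNth_zero_eq]
    fin_cases k <;> simp [diagPt]
  have eT : chartMap (sandwich weyl.1 weyl.1ᴴ ∘ₗ adjCoeffs) 0 0 (diagPt s) = diagPt s := by
    ext k
    simp only [chartMap, sandwich_weyl_adjCoeffs, insertNth_zero_eq]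
    fin_cases k <;> simp [diagPt]
  have eψ : ∀ u : C3, ψ u = ![u 1, u 0, u 2] := fun u => by
    rw [hψu]
    ext k
    simp only [sandwich_weyl_adjCoeffs, insertNth_zero_eq]
    fin_cases k <;> simp [diagPt]
  simp only [eI, eφ] at h1
  simp only [eT, eψ]
  exact bilin_swap (chartMetric_symm g 0 _) (chartMetric_smul_I hK hq) h1
    (form_orbit_eq_zero hK hG hs)

/-! ### Inversion is an isometry -/

theorem preservesMetric_inv {g : Metric} (hK : IsKaehler g) (hG : IsInvariant g) :
    PreservesMetric g fun p => p⁻¹ := by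
  have hact : ∀ U V p, PreservesMetricAt g (act U V) p := hG
  have dact : ∀ U V p, MDifferentiableAt 𝓘(ℝ, C3) 𝓘(ℝ, C3) (act U V) p :=
    fun U V p => (induces_act U V).mdifferentiableAt p
  have dinv := induces_inv.mdifferentiableAt
  have hdiag : ∀ s : ℝ, 0 < s →
      PreservesMetricAt g (fun p => p⁻¹) (chartInv 0 (diagPt s)) := fun s hs => by
    have h := (hact weyl⁻¹ weyl⁻¹ _).comp (preservesMetricAt_transpose hK hG hs) (dact _ _ _)
      (((induces_act weyl weyl).comp induces_inv).mdifferentiableAt _)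
    convert h using 1
    ext1 p
    exact (weyl_act_act _).symm
  intro p
  obtain ⟨U, V, s, hs, hp⟩ := exists_act_diagPt p
  have hp' : act U⁻¹ V⁻¹ p = chartInv 0 (diagPt s) := by
    rw [hp]
    simp only [act, map_inv]
    group
  have h1 : PreservesMetricAt g ((fun p => p⁻¹) ∘ act U⁻¹ V⁻¹) p :=
    PreservesMetricAt.comp (by rw [hp']; exact hdiag s hs) (hact _ _ _) (dinv _) (dact _ _ _)
  have h2 := (hact V U _).comp h1 (dact _ _ _) ((dinv _).comp p (dact _ _ _))
  -- Inversion turns the action of `(U, V)` into that of `(V, U)`.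
  have e : (fun p : Rat1 => p⁻¹) = act V U ∘ (fun p => p⁻¹) ∘ act U⁻¹ V⁻¹ := by
    ext1 p
    simp only [Function.comp_apply, act, map_inv]
    group
  rw [← e] at h2
  exact h2

theorem isIsometry_inv {g : Metric} (hK : IsKaehler g) (hG : IsInvariant g) :
    IsIsometry g fun p => p⁻¹ := by
  have h : ContMDiff 𝓘(ℝ, C3) 𝓘(ℝ, C3) ∞ fun p : Rat1 => p⁻¹ :=
    (induces_inv.contMDiff ℝ).of_le (by simp)
  exact ⟨⟨⟨Equiv.inv Rat1, h, h⟩, rfl⟩, preservesMetric_inv hK hG⟩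

end RatOne

/-- Identify `TSO(3)` with `SO(3) × ℝ³` by left-invariant fields and with the space of rational maps
of degree one by polar decomposition. The differential of the inversion of `SO(3)` is
`(R, λ) ↦ (R⁻¹, -Ad_R λ)`, and it is an isometry of every invariant Kähler metric. -/
theorem mainTheorem2 (g : RatOne.Metric) (hK : RatOne.IsKaehler g) (hG : RatOne.IsInvariant g) :
    (∀ (R : RatOne.SO3) (l : Fin 3 → ℝ),
      RatOne.dInv (RatOne.leftTriv (R, l)) = RatOne.leftTriv (R⁻¹, -(R.1 *ᵥ l))) ∧
    RatOne.IsIsometry g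
      (RatOne.identification ∘ RatOne.dInv ∘ RatOne.identification.symm) := by
  refine ⟨RatOne.dInv_leftTriv, ?_⟩
  rw [RatOne.identification_dInv]
  exact RatOne.isIsometry_inv hK hG
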